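/- Let $A$ be a commutative ring with unit, let $R$ be a commutative $A$-algebra, let $n\ge 1$, and let $F$ be a free $A$-module of rank $n$ with a distinguished element $e$ that is part of a basis of $F$. Let $\mathcal{H}ilb^n_{R/A}$ be the functor from commutative $A$-algebras to sets that sends $B$ to the set of surjective $B$-algebra homomorphisms $B\otimes_A R\to Q$, where $Q$ is a locally free $B$-module of rank $n$ (two such surjections being identified when they have the same kernel, that is, when they differ by an isomorphism of their targets), and that sends $B\to C$ to $(B\otimes_AR\to Q)\mapsto (C\otimes_AR\to C\otimes_BQ)$. For an $A$-module homomorphism $\beta:F\to R$ with $\beta(e)=1$, let $\mathcal{H}ilb^\beta_{R/A}\subseteq\mathcal{H}ilb^n_{R/A}$ be the subfunctor of those $B\otimes_AR\to Q$ for which the composite $B\otimes_AF\xrightarrow{\mathrm{id}\otimes\beta}B\otimes_AR\to Q$ is surjective. Notation. For a homomorphism $u:N\to P$ of modules over a ring $B$, with $P$ free of finite rank, let $\mathfrak I_Z(u)\subseteq B$ be the ideal of zeroes of $u$, that is, the image of $N\otimes_B P^\vee\to P\otimes_B P^\vee\xrightarrow{\mathrm{ev}}B$; for an element $p\in P$ let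 $\mathfrak I_Z(p)$ be that of the map $B\to P$, $1\mapsto p$. Let $M$ be an $A$-module and $\pi:\operatorname{Sym}_A(M)\to R$ a surjective $A$-algebra homomorphism with kernel $\mathfrak I$ (every $R$ has such presentations, for example with $M=R$). Let $S=\operatorname{Sym}_A(M\otimes_A\operatorname{End}_A(F)^\vee)$, let $t\in\operatorname{End}_A(F)^\vee\otimes_A\operatorname{End}_A(F)$ be the element corresponding to the identity of $\operatorname{End}_A(F)$, and let $\mu:S\otimes_AM\to S\otimes_A\operatorname{End}_A(F)$ be the $S$-linear map with $\mu(1\otimes x)=x\otimes t$. (a) Let $H$ be the quotient of $S$ by the ideal generated by all $\mathfrak I_Z\bigl(\mu(1\otimes x)\mu(1\otimes y)-\mu(1\otimes y)\mu(1\otimes x)\bigr)$, $x,y\in M$, and let $\mu_H:H\otimes_A\operatorname{Sym}_A(M)\to H\otimes_A\operatorname{End}_A(F)$ be the $H$-algebra homomorphism for which $\mu_H(1\otimes x)$ is the image of $\mu(1\otimes x)$, for all $x\in M$. (b) Let $H_R=H/\mathfrak I_Z(v)$, where $v$ is the composite $H\otimes_A\mathfrak I\to H\otimes_A\operatorname{Sym}_A(M)\xrightarrow{\mu_H}H\otimes_A\operatorname{End}_A(F)$,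 and let $\mu_{H_R}:H_R\otimes_AR\to H_R\otimes_A\operatorname{End}_A(F)$ be the $H_R$-algebra homomorphism induced by $\mu_H$. (c) For $\beta:F\to R$ with $\beta(e)=1$ let $H_R^\beta=H_R/\mathfrak I_Z(\mathrm{id}-u)$, where $u$ is the composite $H_R\otimes_AF\xrightarrow{\mathrm{id}\otimes\beta}H_R\otimes_AR\xrightarrow{\mu_{H_R}}H_R\otimes_A\operatorname{End}_A(F)\xrightarrow{\mathrm{id}\otimes\mathrm{ev}_e}H_R\otimes_AF$ with $\mathrm{ev}_e(w)=w(e)$, and let $\mu_{H_R^\beta}:H_R^\beta\otimes_AR\to H_R^\beta\otimes_AF$ be the composite of the base change of $\mu_{H_R}$ to $H_R^\beta$ with $\mathrm{id}\otimes\mathrm{ev}_e$. **Theorem.** 1. The functor $\mathcal{H}ilb^n_{R/A}$ is representable: there is a scheme $X$ over $\operatorname{Spec}(A)$ with isomorphisms $\operatorname{Hom}_{\operatorname{Spec}(A)}(\operatorname{Spec}(B),X)\cong\mathcal{H}ilb^n_{R/A}(B)$ that are natural in the $A$-algebra $B$. 2. The subfunctors $\mathcal{H}ilb^\beta_{R/A}$,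 for all $A$-module homomorphisms $\beta:F\to R$ with $\beta(e)=1$, form an open covering of $\mathcal{H}ilb^n_{R/A}$. That is, for each $\beta$, each $B$ and each $x\in\mathcal{H}ilb^n_{R/A}(B)$ there is an open subset $U\subseteq\operatorname{Spec}(B)$ such that for every homomorphism of $A$-algebras $B\to C$ the image of $x$ lies in $\mathcal{H}ilb^\beta_{R/A}(C)$ if and only if $\operatorname{Spec}(C)\to\operatorname{Spec}(B)$ has its image in $U$; and for each $B$, each $x\in\mathcal{H}ilb^n_{R/A}(B)$ and each prime ideal $\mathfrak p$ of $B$ there are $f\in B\setminus\mathfrak p$ and $\beta$ such that the image of $x$ in $\mathcal{H}ilb^n_{R/A}(B_f)$ lies in $\mathcal{H}ilb^\beta_{R/A}(B_f)$. 3. For every presentation $\pi$ and every $\beta$ as above, the map $\mu_{H_R^\beta}:H_R^\beta\otimes_AR\to H_R^\beta\otimes_AF$ is surjective, its kernel is an ideal, it takes $1\otimes1$ to $1\otimes e$, and its composite with $\mathrm{id}\otimes\beta$ is the identity of $H_R^\beta\otimes_AF$; and there is a natural isomorphism of functors $\operatorname{Hom}_{A\text{-alg}}(H_R^\beta,-)\to\mathcal{H}ilb^\beta_{R/A}$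 that maps $\mathrm{id}_{H_R^\beta}$ to the class of $\mu_{H_R^\beta}$. That is, $\mathcal{H}ilb^\beta_{R/A}$ is represented by the $A$-algebra $H_R^\beta$ with universal family $\mu_{H_R^\beta}$. -/

import Mathlib

open CategoryTheory TensorProduct

universe u

namespace HilbertPoints

noncomputable section

/-! ### Locally free modules of rank `n` -/

/-- `Q` is a locally free `B`-module of rank `n`: every prime of `B` has a basic open
neighbourhood `D(f)` on which `B_f ⊗ Q` is free of rank `n` over `B_f`. -/
def IsLocallyFreeOfRank (B : Type*) [CommRing B] (Q : Type*) [AddCommGroup Q] [Module B Q]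
    (n : ℕ) : Prop :=
  ∀ p : PrimeSpectrum B, ∃ f : B, f ∉ p.asIdeal ∧
    Nonempty ((Localization.Away f ⊗[B] Q) ≃ₗ[Localization.Away f] (Fin n → Localization.Away f))

theorem IsLocallyFreeOfRank.congr {B : Type*} [CommRing B] {Q Q' : Type*} [AddCommGroup Q]
    [Module B Q] [AddCommGroup Q'] [Module B Q'] {n : ℕ} (h : IsLocallyFreeOfRank B Q n)
    (e : Q ≃ₗ[B] Q') : IsLocallyFreeOfRank B Q' n := by
  intro p
  obtain ⟨f, hf, ⟨g⟩⟩ := h p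
  exact ⟨f, hf, ⟨(e.baseChange B (Localization.Away f) Q Q').symm ≪≫ₗ g⟩⟩

theorem IsLocallyFreeOfRank.baseChange {B : Type*} [CommRing B] {Q : Type*} [AddCommGroup Q]
    [Module B Q] {n : ℕ} (h : IsLocallyFreeOfRank B Q n) (C : Type*) [CommRing C] [Algebra B C] :
    IsLocallyFreeOfRank C (C ⊗[B] Q) n := by
  intro p
  obtain ⟨f, hf, ⟨g⟩⟩ := h (PrimeSpectrum.comap (algebraMap B C) p)
  refine ⟨algebraMap B C f, hf, ?_⟩
  let _ : Algebra (Localization.Away f) (Localization.Away (algebraMap B C f)) :=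
    (Localization.awayMap (algebraMap B C) f).toAlgebra
  have : IsScalarTower B (Localization.Away f) (Localization.Away (algebraMap B C f)) := by
    refine IsScalarTower.of_algebraMap_eq fun x => ?_
    rw [RingHom.algebraMap_toAlgebra, Localization.awayMap, IsLocalization.Away.map,
      IsLocalization.map_eq, ← IsScalarTower.algebraMap_apply B C]
  exact ⟨AlgebraTensorModule.cancelBaseChange B C _ _ Q ≪≫ₗ
    (AlgebraTensorModule.cancelBaseChange B (Localization.Away f) _ _ Q).symm ≪≫ₗ
    g.baseChange (Localization.Away f) (Localization.Away (algebraMap B C f)) _ _ ≪≫ₗ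
    TensorProduct.piScalarRight _ _ _ _⟩

/-! ### The Hilbert functor of `n` points -/

section Hilb

variable {A : Type u} [CommRing A] (R : Type u) [CommRing R] [Algebra A R]

/-- The ring homomorphism `φ ⊗ id_R : B ⊗ R → C ⊗ R`. -/
abbrev baseMap {B C : Type*} [CommRing B] [CommRing C] [Algebra A B] [Algebra A C]
    (φ : B →ₐ[A] C) : B ⊗[A] R →ₐ[A] C ⊗[A] R :=
  Algebra.TensorProduct.map φ (AlgHom.id A R)

/-- Base change of quotients of `B ⊗ R`: for a quotient `Q = (B ⊗ R)/I`, the `C`-algebra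
`C ⊗_B Q` is the quotient of `C ⊗ R` by the ideal generated by the image of `I`. -/
theorem nonempty_quotient_equiv {B C : Type*} [CommRing B] [CommRing C] [Algebra A B]
    [Algebra A C] [Algebra B C] [IsScalarTower A B C] (I : Ideal (B ⊗[A] R)) :
    Nonempty ((C ⊗[B] ((B ⊗[A] R) ⧸ I)) ≃ₐ[C]
      ((C ⊗[A] R) ⧸ I.map (baseMap R (IsScalarTower.toAlgHom A B C)))) := by
  let e := Algebra.TensorProduct.cancelBaseChange A B C C R
  let q : C ⊗[B] (B ⊗[A] R) →ₐ[C] C ⊗[B] ((B ⊗[A] R) ⧸ I) :=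
    Algebra.TensorProduct.map (AlgHom.id C C) (Ideal.Quotient.mkₐ B I)
  have hq : Function.Surjective q :=
    LinearMap.lTensor_surjective C (g := (Ideal.Quotient.mkₐ B I).toLinearMap)
      (Ideal.Quotient.mkₐ_surjective B I)
  have hker : RingHom.ker q = I.map
      (Algebra.TensorProduct.includeRight : B ⊗[A] R →ₐ[B] C ⊗[B] (B ⊗[A] R)) := by
    have := Algebra.TensorProduct.lTensor_ker (A := C) (Ideal.Quotient.mkₐ B I)
      (Ideal.Quotient.mkₐ_surjective B I)
    have h0 : RingHom.ker (Ideal.Quotient.mkₐ B I) = I := Ideal.Quotient.mkₐ_ker B I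
    rw [h0] at this
    exact this
  let f : C ⊗[A] R →ₐ[C] C ⊗[B] ((B ⊗[A] R) ⧸ I) := q.comp e.symm.toAlgHom
  have hf : Function.Surjective f := hq.comp e.symm.surjective
  have hfk : RingHom.ker f = I.map (baseMap R (IsScalarTower.toAlgHom A B C)) := by
    have h1 : RingHom.ker f = (RingHom.ker q).comap (e.symm : C ⊗[A] R ≃+* _) := rfl
    rw [h1, hker, ← Ideal.map_symm]
    change Ideal.map (RingHomClass.toRingHom e) (Ideal.map (RingHomClass.toRingHom
      (Algebra.TensorProduct.includeRight : B ⊗[A] R →ₐ[B] C ⊗[B] (B ⊗[A] R))) I) =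
      Ideal.map (baseMap R (IsScalarTower.toAlgHom A B C)).toRingHom I
    rw [Ideal.map_map]
    congr 1
    refine RingHom.ext fun x => ?_
    induction x with
    | zero => simp
    | tmul b r => simp [e, Algebra.smul_def]
    | add x y hx hy => rw [map_add, map_add, hx, hy]
  exact ⟨(Ideal.quotientKerAlgEquivOfSurjective hf).symm.trans (Ideal.quotientEquivAlgOfEq C hfk)⟩

/-- A `B`-point of the Hilbert functor of `n` points of `R` over `A`: a surjective `B`-algebra
homomorphism `B ⊗ R → Q` with `Q` locally free of rank `n`. Two surjections that differ by an
isomorphism of the targets are the same point, so a point is given by the kernel. -/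
@[ext]
structure HilbPoint (n : ℕ) (B : Type u) [CommRing B] [Algebra A B] where
  ideal : Ideal (B ⊗[A] R)
  isLocallyFree : IsLocallyFreeOfRank B ((B ⊗[A] R) ⧸ ideal) n

variable {R} in
/-- The image of a point under `φ : B → C`: the surjection `B ⊗ R → Q` is sent to
`C ⊗ R = C ⊗_B (B ⊗ R) → C ⊗_B Q`. -/
def HilbPoint.map {n : ℕ} {B C : Type u} [CommRing B] [CommRing C] [Algebra A B] [Algebra A C]
    (φ : B →ₐ[A] C) (x : HilbPoint (A := A) R n B) : HilbPoint (A := A) R n C where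
  ideal := x.ideal.map (baseMap R φ)
  isLocallyFree := by
    let _ : Algebra B C := φ.toRingHom.toAlgebra
    have : IsScalarTower A B C := IsScalarTower.of_algebraMap_eq fun r => (φ.commutes r).symm
    obtain ⟨e⟩ := nonempty_quotient_equiv (A := A) R (C := C) x.ideal
    exact (x.isLocallyFree.baseChange C).congr e.toLinearEquiv

theorem HilbPoint.map_id {n : ℕ} {B : Type u} [CommRing B] [Algebra A B]
    (x : HilbPoint (A := A) R n B) : x.map (AlgHom.id A B) = x := by
  refine HilbPoint.ext ?_
  change Ideal.map (baseMap R (AlgHom.id A B)) x.ideal = x.ideal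
  rw [baseMap, Algebra.TensorProduct.map_id]
  exact Ideal.map_id x.ideal

theorem HilbPoint.map_comp {n : ℕ} {B C D : Type u} [CommRing B] [CommRing C] [CommRing D]
    [Algebra A B] [Algebra A C] [Algebra A D] (φ : B →ₐ[A] C) (ψ : C →ₐ[A] D)
    (x : HilbPoint (A := A) R n B) : x.map (ψ.comp φ) = (x.map φ).map ψ := by
  refine HilbPoint.ext ?_
  change Ideal.map (baseMap R (ψ.comp φ)).toRingHom x.ideal =
    Ideal.map (baseMap R ψ).toRingHom (Ideal.map (baseMap R φ).toRingHom x.ideal)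
  rw [Ideal.map_map]
  congr 1
  refine RingHom.ext fun y => ?_
  induction y with
  | zero => simp
  | tmul b r => simp
  | add x y hx hy => rw [RingHom.map_add, RingHom.map_add, hx, hy]

variable (A) in
/-- The Hilbert functor of `n` points of `R` over `A`, on commutative `A`-algebras. -/
def hilb (n : ℕ) : CommAlgCat.{u} A ⥤ Type u where
  obj B := HilbPoint (A := A) R n B
  map φ := ↾fun x => x.map φ.hom
  map_id B := by
    ext x : 3
    exact HilbPoint.map_id R x
  map_comp φ ψ := by
    ext x : 3
    exact HilbPoint.map_comp R φ.hom ψ.hom x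

variable {R} {F : Type u} [AddCommGroup F] [Module A F]

/-- The composite `B ⊗ F → B ⊗ R → (B ⊗ R)/I` of `id_B ⊗ β` with the residue map. -/
def sectionMap (β : F →ₗ[A] R) (B : Type u) [CommRing B] [Algebra A B] (I : Ideal (B ⊗[A] R)) :
    B ⊗[A] F →ₗ[B] (B ⊗[A] R) ⧸ I :=
  (Ideal.Quotient.mkₐ B I).toLinearMap ∘ₗ β.baseChange B

theorem sectionMap_map_surjective (β : F →ₗ[A] R) {B C : Type u} [CommRing B] [CommRing C]
    [Algebra A B] [Algebra A C] (φ : B →ₐ[A] C) (I : Ideal (B ⊗[A] R))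
    (h : Function.Surjective (sectionMap β B I)) :
    Function.Surjective (sectionMap β C (I.map (baseMap R φ))) := by
  rw [← LinearMap.range_eq_top, eq_top_iff]
  rintro y -
  obtain ⟨y, rfl⟩ := Ideal.Quotient.mk_surjective y
  induction y with
  | zero => rw [map_zero]; exact zero_mem _
  | add x y hx hy => rw [map_add]; exact add_mem hx hy
  | tmul c r =>
    obtain ⟨z, hz⟩ := h (Ideal.Quotient.mk I (1 ⊗ₜ r))
    have hz' : β.baseChange B z - 1 ⊗ₜ r ∈ I := Ideal.Quotient.eq.mp hz
    have h1 : ∀ z : B ⊗[A] F, baseMap R φ (β.baseChange B z) =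
        β.baseChange C (φ.toLinearMap.rTensor F z) := by
      intro z
      induction z with
      | zero => simp
      | tmul b f => simp
      | add x y hx hy => rw [map_add, map_add, map_add, map_add, hx, hy]
    have h2 := Ideal.mem_map_of_mem (baseMap R φ) hz'
    rw [map_sub, h1] at h2
    have h3 := Ideal.Quotient.eq.mpr h2
    refine ⟨c • φ.toLinearMap.rTensor F z, ?_⟩
    rw [map_smul]
    change c • Ideal.Quotient.mk _ (β.baseChange C (φ.toLinearMap.rTensor F z)) = _
    rw [h3]
    change Ideal.Quotient.mk _ (c • baseMap R φ (1 ⊗ₜ r)) = _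
    simp [TensorProduct.smul_tmul']

/-- The subfunctor of the Hilbert functor attached to `β : F → R`: the points `B ⊗ R → Q` such
that `B ⊗ F → B ⊗ R → Q` is surjective. -/
def hilbSection (n : ℕ) (β : F →ₗ[A] R) : Subfunctor (hilb A R n) where
  obj B := {x : HilbPoint (A := A) R n B | Function.Surjective (sectionMap β B x.ideal)}
  map φ := fun x hx => sectionMap_map_surjective β φ.hom x.ideal hx

end Hilb

/-! ### Open subfunctors, open coverings and points of a scheme -/

section Open

variable {A : Type u} [CommRing A] {H : CommAlgCat.{u} A ⥤ Type u}

/-- `G ⊆ H` is an open subfunctor: for every `x ∈ H(B)` there is an open `U ⊆ Spec B` such that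
a homomorphism `φ : B → C` takes `x` into `G(C)` if and only if `Spec C → Spec B` factors
through `U`. -/
def IsOpenSubfunctor (G : Subfunctor H) : Prop :=
  ∀ (B : CommAlgCat.{u} A) (x : H.obj B), ∃ U : TopologicalSpace.Opens (PrimeSpectrum B),
    ∀ (C : CommAlgCat.{u} A) (φ : B ⟶ C),
      H.map φ x ∈ G.obj C ↔
        Set.range (PrimeSpectrum.comap (φ.hom : B →+* C)) ⊆ (U : Set (PrimeSpectrum B))

/-- The localization homomorphism `B → B_f` in the category of `A`-algebras. -/
def awayHom (B : CommAlgCat.{u} A) (f : B) : B ⟶ CommAlgCat.of A (Localization.Away f) :=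
  CommAlgCat.ofHom (IsScalarTower.toAlgHom A B (Localization.Away f))

/-- The `G i` form an open covering of `H`: they are open subfunctors, and for every `x ∈ H(B)`
every prime of `B` has a basic open neighbourhood `D(f)` such that the restriction of `x` to
`D(f)` lies in some `G i`. -/
def IsOpenCovering {ι : Type*} (G : ι → Subfunctor H) : Prop :=
  (∀ i, IsOpenSubfunctor (G i)) ∧
    ∀ (B : CommAlgCat.{u} A) (x : H.obj B) (p : PrimeSpectrum B),
      ∃ f : B, f ∉ p.asIdeal ∧ ∃ i,
        H.map (awayHom B f) x ∈ (G i).obj (CommAlgCat.of A (Localization.Away f))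

/-- The functor of points `B ↦ Hom_{Spec A}(Spec B, X)` of a scheme `X` over `Spec A`, on
`A`-algebras. -/
def pointsFunctor (X : Over (AlgebraicGeometry.Spec (CommRingCat.of A))) :
    CommAlgCat.{u} A ⥤ Type u :=
  (AlgebraicGeometry.algSpec (CommRingCat.of A)).rightOp ⋙ yoneda.obj X

/-- `H` is represented by a scheme over `Spec A`. -/
def IsRepresentableByScheme (H : CommAlgCat.{u} A ⥤ Type u) : Prop :=
  ∃ X : Over (AlgebraicGeometry.Spec (CommRingCat.of A)), Nonempty (pointsFunctor X ≅ H)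

end Open

/-! ### The functors of homomorphisms -/

section Hom

variable {A : Type u} [CommRing A]

/-- The `B`-module homomorphism `u : B ⊗ R → B ⊗ F` belongs to `Hom^β_B(R, F)`: it is surjective,
its kernel is an ideal, `u(1 ⊗ 1) = 1 ⊗ e`, and `u ∘ (id_B ⊗ β)` is the identity. -/
structure IsSectionHom {R F : Type u} [CommRing R] [Algebra A R] [AddCommGroup F] [Module A F]
    (e : F) (β : F →ₗ[A] R) {B : Type u} [CommRing B] [Algebra A B]
    (u : B ⊗[A] R →ₗ[B] B ⊗[A] F) : Prop where
  surjective : Function.Surjective u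
  ker_isIdeal : ∃ I : Ideal (B ⊗[A] R), I.restrictScalars B = LinearMap.ker u
  map_one : u (1 ⊗ₜ 1) = 1 ⊗ₜ e
  comp_section : u ∘ₗ β.baseChange B = LinearMap.id

/-- The point `x` is the class of the surjection `u : B ⊗ R → B ⊗ F`, that is, the ideal of `x`
is the kernel of `u`. -/
def HilbPoint.IsClassOf {R F : Type u} [CommRing R] [Algebra A R] [AddCommGroup F] [Module A F]
    {n : ℕ} {B : Type u} [CommRing B] [Algebra A B] (x : HilbPoint (A := A) R n B)
    (u : B ⊗[A] R →ₗ[B] B ⊗[A] F) : Prop :=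
  x.ideal.restrictScalars B = LinearMap.ker u

/-- For `φ : B → C` and a `B`-linear `u : B ⊗ M → B ⊗ N`, the `C`-linear map
`C ⊗ M → C ⊗ N` obtained by base change. -/
def homMap {M N : Type*} [AddCommGroup M] [Module A M] [AddCommGroup N] [Module A N]
    {B C : Type*} [CommRing B] [CommRing C] [Algebra A B] [Algebra A C] (φ : B →ₐ[A] C)
    (u : B ⊗[A] M →ₗ[B] B ⊗[A] N) : C ⊗[A] M →ₗ[C] C ⊗[A] N :=
  LinearMap.liftBaseChange C
    (φ.toLinearMap.rTensor N ∘ₗ u.restrictScalars A ∘ₗ TensorProduct.mk A B M 1)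

/-- An `A`-algebra homomorphism `R → C ⊗ E` extended to a `C`-algebra homomorphism
`C ⊗ R → C ⊗ E`. -/
def algLift {R E : Type*} [CommRing R] [Algebra A R] [Ring E] [Algebra A E]
    {C : Type*} [CommRing C] [Algebra A C] (g : R →ₐ[A] C ⊗[A] E) : C ⊗[A] R →ₐ[C] C ⊗[A] E :=
  Algebra.TensorProduct.lift (Algebra.ofId C (C ⊗[A] E)) g
    fun c x => (Algebra.commute_algebraMap_left c (g x) :)

theorem algLift_tmul {R E : Type*} [CommRing R] [Algebra A R] [Ring E] [Algebra A E]
    {C : Type*} [CommRing C] [Algebra A C] (g : R →ₐ[A] C ⊗[A] E) (c : C) (r : R) :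
    algLift g (c ⊗ₜ r) = c • g r := by
  rw [Algebra.smul_def]
  exact Algebra.TensorProduct.lift_tmul _ _ _ _ _

/-- For `φ : B → C` and a `B`-algebra homomorphism `u : B ⊗ R → B ⊗ E`, the `C`-algebra
homomorphism `C ⊗ R → C ⊗ E` obtained by base change. -/
def homAlgMap {R E : Type*} [CommRing R] [Algebra A R] [Ring E] [Algebra A E]
    {B C : Type*} [CommRing B] [CommRing C] [Algebra A B] [Algebra A C] (φ : B →ₐ[A] C)
    (u : B ⊗[A] R →ₐ[B] B ⊗[A] E) : C ⊗[A] R →ₐ[C] C ⊗[A] E :=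
  algLift (((Algebra.TensorProduct.map φ (AlgHom.id A E)).comp (u.restrictScalars A)).comp
    Algebra.TensorProduct.includeRight)

/-- The ideal of zeroes of `u : N → P`: the image of `N ⊗ P^∨ → P ⊗ P^∨ → A`. -/
def zeroIdeal {N P : Type*} [AddCommGroup N] [Module A N] [AddCommGroup P] [Module A P]
    (u : N →ₗ[A] P) : Ideal A :=
  LinearMap.range (contractRight A P ∘ₗ u.rTensor (Module.Dual A P))

theorem apply_mem_zeroIdeal {N P : Type*} [AddCommGroup N] [Module A N] [AddCommGroup P]
    [Module A P] (u : N →ₗ[A] P) (x : N) (ξ : Module.Dual A P) : ξ (u x) ∈ zeroIdeal u :=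
  ⟨x ⊗ₜ ξ, by simp⟩

/-- If the ideal of zeroes of `u : N → B ⊗ E` is killed by `φ : B → C`, then `u` composed with
`B ⊗ E → C ⊗ E` is zero. -/
theorem map_eq_zero_of_zeroIdeal_le {E : Type*} [AddCommGroup E] [Module A E] [Module.Free A E]
    {B C : Type*} [CommRing B] [CommRing C] [Algebra A B] [Algebra A C]
    (φ : B →ₐ[A] C) {N : Type*} [AddCommGroup N] [Module B N] (u : N →ₗ[B] B ⊗[A] E)
    (h : zeroIdeal u ≤ RingHom.ker φ) (x : N) : φ.toLinearMap.rTensor E (u x) = 0 := by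
  let b := Module.Free.chooseBasis A E
  let b' := b.baseChange B
  rw [← b'.linearCombination_repr (u x), Finsupp.linearCombination_apply, Finsupp.sum, map_sum]
  refine Finset.sum_eq_zero fun i _ => ?_
  have hi : φ (b'.repr (u x) i) = 0 := h (apply_mem_zeroIdeal u x (b'.coord i))
  simp [b', TensorProduct.smul_tmul', hi]

end Hom

/-! ### The algebras `H`, `H_R` and `H_R^β` -/

section Universal

/-- An `A`-linear map from `M` to an `A`-algebra with commuting values extends to the symmetric
algebra. -/
def symLift {A M E : Type*} [CommRing A] [AddCommGroup M] [Module A M] [Ring E] [Algebra A E]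
    (g : M →ₗ[A] E) (hg : ∀ x y, g x * g y = g y * g x) : SymmetricAlgebra A M →ₐ[A] E :=
  RingCon.liftₐ (TensorAlgebra.symRingCon A M) (TensorAlgebra.lift A g) (by
    refine RingCon.ringConGen_le.2 fun x y h => ?_
    cases h with
    | mul_comm x y => simpa [RingCon.ker_apply] using hg x y)

theorem symLift_ι {A M E : Type*} [CommRing A] [AddCommGroup M] [Module A M] [Ring E]
    [Algebra A E] (g : M →ₗ[A] E) (hg : ∀ x y, g x * g y = g y * g x) (x : M) :
    symLift g hg (SymmetricAlgebra.ι A M x) = g x :=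
  TensorAlgebra.lift_ι_apply g x

/-- An algebra homomorphism that vanishes on the kernel of the surjection `π` descends along
`π`. -/
def descend {A S R E : Type*} [CommRing A] [CommRing S] [Algebra A S] [CommRing R] [Algebra A R]
    [Ring E] [Algebra A E] (π : S →ₐ[A] R) (hπ : Function.Surjective π) (g : S →ₐ[A] E)
    (hg : ∀ x ∈ RingHom.ker π, g x = 0) : R →ₐ[A] E :=
  (Ideal.Quotient.liftₐ (RingHom.ker π) g hg).comp
    (Ideal.quotientKerAlgEquivOfSurjective hπ).symm.toAlgHom

theorem descend_apply {A S R E : Type*} [CommRing A] [CommRing S] [Algebra A S] [CommRing R]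
    [Algebra A R] [Ring E] [Algebra A E] (π : S →ₐ[A] R) (hπ : Function.Surjective π)
    (g : S →ₐ[A] E) (hg : ∀ x ∈ RingHom.ker π, g x = 0) (x : S) :
    descend π hπ g hg (π x) = g x := by
  have h : (Ideal.quotientKerAlgEquivOfSurjective hπ).symm (π x) =
      Ideal.Quotient.mk (RingHom.ker π) x :=
    Ideal.quotientKerAlgEquivOfSurjective_symm_apply hπ x
  change Ideal.Quotient.liftₐ (RingHom.ker π) g hg
    ((Ideal.quotientKerAlgEquivOfSurjective hπ).symm (π x)) = g x
  rw [h]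
  rfl

variable (A : Type u) [CommRing A] (F : Type u) [AddCommGroup F] [Module A F]
  [Module.Free A F] [Module.Finite A F] (M : Type u) [AddCommGroup M] [Module A M]

/-- The element `t(1)` of `End(F)^∨ ⊗ End(F)`, dual to the evaluation map; it corresponds to the
identity of `End(F)`. -/
def coevEnd : Module.Dual A (Module.End A F) ⊗[A] Module.End A F :=
  (dualTensorHomEquiv A (Module.End A F) (Module.End A F)).symm LinearMap.id

/-- The symmetric algebra `Sym_A(M ⊗ End_A(F)^∨)`. -/
abbrev SymEnd : Type u := SymmetricAlgebra A (M ⊗[A] Module.Dual A (Module.End A F))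

/-- The `A`-linear map `M → Sym_A(M ⊗ End_A(F)^∨) ⊗ End_A(F)`, `x ↦ x ⊗ t(1)`. -/
def muAux : M →ₗ[A] SymEnd A F M ⊗[A] Module.End A F :=
  (SymmetricAlgebra.ι A (M ⊗[A] Module.Dual A (Module.End A F))).rTensor (Module.End A F) ∘ₗ
    (TensorProduct.assoc A M (Module.Dual A (Module.End A F)) (Module.End A F)).symm.toLinearMap ∘ₗ
    (TensorProduct.mk A M (Module.Dual A (Module.End A F) ⊗[A] Module.End A F)).flip (coevEnd A F)

/-- The universal homomorphism
`μ : Sym_A(M ⊗ End_A(F)^∨) ⊗ M → Sym_A(M ⊗ End_A(F)^∨) ⊗ End_A(F)`. -/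
def mu : SymEnd A F M ⊗[A] M →ₗ[SymEnd A F M] SymEnd A F M ⊗[A] Module.End A F :=
  LinearMap.liftBaseChange (SymEnd A F M) (muAux A F M)

/-- The commutator `μ(1 ⊗ x) μ(1 ⊗ y) - μ(1 ⊗ y) μ(1 ⊗ x)`. -/
def muCommutator (x y : M) : SymEnd A F M ⊗[A] Module.End A F :=
  mu A F M (1 ⊗ₜ x) * mu A F M (1 ⊗ₜ y) - mu A F M (1 ⊗ₜ y) * mu A F M (1 ⊗ₜ x)

/-- The smallest ideal containing the ideals of zeroes of all the commutators. -/
def idealH : Ideal (SymEnd A F M) :=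
  ⨆ (x : M) (y : M), zeroIdeal (LinearMap.toSpanSingleton (SymEnd A F M)
    (SymEnd A F M ⊗[A] Module.End A F) (muCommutator A F M x y))

/-- The algebra `H`. -/
def AlgH : Type u := SymEnd A F M ⧸ idealH A F M

instance : CommRing (AlgH A F M) := inferInstanceAs (CommRing (SymEnd A F M ⧸ idealH A F M))

instance : Algebra A (AlgH A F M) := inferInstanceAs (Algebra A (SymEnd A F M ⧸ idealH A F M))

/-- The residue class homomorphism `ρ_H`. -/
def rhoH : SymEnd A F M →ₐ[A] AlgH A F M := Ideal.Quotient.mkₐ A (idealH A F M)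

theorem homMap_rhoH_commute (x y : M) :
    homMap (rhoH A F M) (mu A F M) (1 ⊗ₜ x) * homMap (rhoH A F M) (mu A F M) (1 ⊗ₜ y) =
      homMap (rhoH A F M) (mu A F M) (1 ⊗ₜ y) * homMap (rhoH A F M) (mu A F M) (1 ⊗ₜ x) := by
  have h := map_eq_zero_of_zeroIdeal_le (rhoH A F M)
    (LinearMap.toSpanSingleton (SymEnd A F M) (SymEnd A F M ⊗[A] Module.End A F)
      (muCommutator A F M x y)) (by
        refine le_trans (le_iSup₂_of_le x y le_rfl) (le_of_eq ?_ : idealH A F M ≤ _)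
        exact (Ideal.Quotient.mkₐ_ker A (idealH A F M)).symm) 1
  have h' : Algebra.TensorProduct.map (rhoH A F M) (AlgHom.id A (Module.End A F))
      (muCommutator A F M x y) = 0 := by
    rw [LinearMap.toSpanSingleton_apply, one_smul] at h
    exact h
  have key : ∀ z : M, homMap (rhoH A F M) (mu A F M) (1 ⊗ₜ z) =
      Algebra.TensorProduct.map (rhoH A F M) (AlgHom.id A (Module.End A F))
        (mu A F M (1 ⊗ₜ z)) := by
    intro z
    rw [homMap, LinearMap.liftBaseChange_tmul, one_smul]
    rfl
  rw [key, key, ← sub_eq_zero]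
  rw [muCommutator, map_sub, map_mul, map_mul] at h'
  exact h'

/-- The `H`-algebra homomorphism `μ_H : H ⊗ Sym_A(M) → H ⊗ End_A(F)` determined by
`μ_H(1 ⊗ x) = Hom_{ρ_H}(μ)(1 ⊗ x)` for `x ∈ M`. -/
def muH : AlgH A F M ⊗[A] SymmetricAlgebra A M →ₐ[AlgH A F M] AlgH A F M ⊗[A] Module.End A F :=
  algLift (symLift
    ((homMap (rhoH A F M) (mu A F M)).restrictScalars A ∘ₗ TensorProduct.mk A (AlgH A F M) M 1)
    (homMap_rhoH_commute A F M))

variable {A M} {R : Type u} [CommRing R] [Algebra A R] (π : SymmetricAlgebra A M →ₐ[A] R)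

/-- The composite `v : H ⊗ 𝔍 → H ⊗ Sym_A(M) → H ⊗ End_A(F)`, for `𝔍` the kernel of the
presentation `π : Sym_A(M) → R`. -/
def vMap : AlgH A F M ⊗[A] ((RingHom.ker π).restrictScalars A) →ₗ[AlgH A F M]
    AlgH A F M ⊗[A] Module.End A F :=
  (muH A F M).toLinearMap ∘ₗ ((RingHom.ker π).restrictScalars A).subtype.baseChange (AlgH A F M)

/-- The algebra `H_R`, for `R` presented by `π : Sym_A(M) → R`. -/
def AlgHR : Type u := AlgH A F M ⧸ zeroIdeal (vMap F π)

instance : CommRing (AlgHR F π) := inferInstanceAs (CommRing (AlgH A F M ⧸ zeroIdeal (vMap F π)))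

instance : Algebra A (AlgHR F π) :=
  inferInstanceAs (Algebra A (AlgH A F M ⧸ zeroIdeal (vMap F π)))

/-- The residue homomorphism `ρ_{H_R}`. -/
def rhoHR : AlgH A F M →ₐ[A] AlgHR F π := Ideal.Quotient.mkₐ A (zeroIdeal (vMap F π))

theorem homAlgMap_rhoHR_eq_zero (x : SymmetricAlgebra A M) (hx : x ∈ RingHom.ker π) :
    homAlgMap (rhoHR F π) (muH A F M) (1 ⊗ₜ x) = 0 := by
  have h := map_eq_zero_of_zeroIdeal_le (rhoHR F π) (vMap F π)
    (le_of_eq (Ideal.Quotient.mkₐ_ker A (zeroIdeal (vMap F π))).symm)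
    (1 ⊗ₜ (⟨x, hx⟩ : (RingHom.ker π).restrictScalars A))
  rw [homAlgMap, algLift_tmul, one_smul]
  exact h

/-- The `H_R`-algebra homomorphism `μ_{H_R} : H_R ⊗ R → H_R ⊗ End_A(F)` induced by
`Hom_{ρ_{H_R}}(μ_H)`. -/
def muHR (hπ : Function.Surjective π) :
    AlgHR F π ⊗[A] R →ₐ[AlgHR F π] AlgHR F π ⊗[A] Module.End A F :=
  let g : SymmetricAlgebra A M →ₐ[A] AlgHR F π ⊗[A] Module.End A F :=
    ((homAlgMap (rhoHR F π) (muH A F M)).restrictScalars A).comp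
      Algebra.TensorProduct.includeRight
  algLift (descend π hπ g fun x hx => homAlgMap_rhoHR_eq_zero F π x hx)

variable {F}

/-- The evaluation map `ev_e : End_A(F) → F`. -/
def evalAt (e : F) : Module.End A F →ₗ[A] F := LinearMap.applyₗ e

/-- The composite `u : H_R ⊗ F → H_R ⊗ R → H_R ⊗ End_A(F) → H_R ⊗ F`. -/
def uMap (hπ : Function.Surjective π) (e : F) (β : F →ₗ[A] R) :
    AlgHR F π ⊗[A] F →ₗ[AlgHR F π] AlgHR F π ⊗[A] F :=
  (evalAt e).baseChange (AlgHR F π) ∘ₗ (muHR F π hπ).toLinearMap ∘ₗ β.baseChange (AlgHR F π)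

/-- The algebra `H_R^β`. -/
def AlgHRSection (hπ : Function.Surjective π) (e : F) (β : F →ₗ[A] R) : Type u :=
  AlgHR F π ⧸ zeroIdeal (LinearMap.id - uMap π hπ e β)

instance (hπ : Function.Surjective π) (e : F) (β : F →ₗ[A] R) :
    CommRing (AlgHRSection π hπ e β) :=
  inferInstanceAs (CommRing (AlgHR F π ⧸ zeroIdeal (LinearMap.id - uMap π hπ e β)))

instance (hπ : Function.Surjective π) (e : F) (β : F →ₗ[A] R) :
    Algebra A (AlgHRSection π hπ e β) :=
  inferInstanceAs (Algebra A (AlgHR F π ⧸ zeroIdeal (LinearMap.id - uMap π hπ e β)))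

/-- The residue homomorphism `ρ_{H_R^β}`. -/
def rhoHRSection (hπ : Function.Surjective π) (e : F) (β : F →ₗ[A] R) :
    AlgHR F π →ₐ[A] AlgHRSection π hπ e β :=
  Ideal.Quotient.mkₐ A (zeroIdeal (LinearMap.id - uMap π hπ e β))

/-- The homomorphism `μ_{H_R^β} : H_R^β ⊗ R → H_R^β ⊗ End_A(F)`. -/
def muHRSection (hπ : Function.Surjective π) (e : F) (β : F →ₗ[A] R) :
    AlgHRSection π hπ e β ⊗[A] R →ₐ[AlgHRSection π hπ e β]
      AlgHRSection π hπ e β ⊗[A] Module.End A F :=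
  homAlgMap (rhoHRSection π hπ e β) (muHR F π hπ)

/-- The universal family `H_R^β ⊗ R → H_R^β ⊗ F`: the composite of `μ_{H_R^β}` with
`id ⊗ ev_e`. -/
def universalFamily (hπ : Function.Surjective π) (e : F) (β : F →ₗ[A] R) :
    AlgHRSection π hπ e β ⊗[A] R →ₗ[AlgHRSection π hπ e β] AlgHRSection π hπ e β ⊗[A] F :=
  (evalAt e).baseChange (AlgHRSection π hπ e β) ∘ₗ (muHRSection π hπ e β).toLinearMap

end Universal

end
end HilbertPoints

/-! On the chart of `β`, a point is the same as a matrix representation of `R`. Let `B ⊗ R → Q` be a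
point for which `B ⊗ F → Q` is surjective. A surjection from a free module of rank `n` to a locally
free one of rank `n` is bijective (`IsLocallyFreeOfRank.bijective`), so `Q` may be replaced by `B ⊗
F`. Multiplication in `Q` then becomes a homomorphism `μ : R → B ⊗ End(F)` with `μ(β f)(e) = f`,
called compatible below. Conversely, a compatible `μ` gives the surjection `r ↦ μ(r)(e)`, whose
kernel is an ideal and which is split by `β`. These constructions are mutually inverse
(`exists_isCompatible`, `IsCompatible.isSectionHom`, `IsCompatible.eq_of_ker_eq`).

Compatible homomorphisms are represented by `H_R^β`. Linear maps `M → B ⊗ End(F)` are homomorphisms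
from the symmetric algebra of `M ⊗ End(F)^∨` to `B`. Commutation of the values, vanishing on the
relations of `R`, and compatibility with `β` say that certain elements of free modules vanish, which
is what killing an ideal of zeroes means.

The charts are open: the cokernel of `B ⊗ F → Q` is a finite module, and the chart is the complement
of its support. They cover: over a residue field, `1` extends to a basis of `Q` consisting of images
of elements of `R`, and a `β` adapted to this basis works at that prime, hence near it.

For representability, the chart of `γ` inside the chart of `β` is the nonvanishing locus of one
determinant. The affine charts are therefore glued along basic open sets. The functor of points of
the glued scheme and the Hilbert functor are Zariski sheaves with the same local covering and the
same overlaps, so they are isomorphic (`nonempty_iso_of_isLocalCover`). -/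

namespace HilbertPoints

noncomputable section

/-! ### Base change of quotients of `B ⊗ R` and of their kernels. -/

section BaseChange

theorem rTensor_smul {A E B C : Type*} [CommRing A] [AddCommGroup E] [Module A E] [CommRing B]
    [Algebra A B] [CommRing C] [Algebra A C] (φ : B →ₐ[A] C) (c : B) (y : B ⊗[A] E) :
    φ.toLinearMap.rTensor E (c • y) = φ c • φ.toLinearMap.rTensor E y := by
  induction y with
  | zero => simp
  | add x y hx hy => simp only [smul_add, map_add, hx, hy]
  | tmul b f => simp [smul_tmul']

variable {A : Type u} [CommRing A] {R : Type u} [CommRing R] [Algebra A R]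

theorem baseMap_smul {B C : Type*} [CommRing B] [CommRing C] [Algebra A B] [Algebra A C]
    (φ : B →ₐ[A] C) (b : B) (z : B ⊗[A] R) : baseMap R φ (b • z) = φ b • baseMap R φ z :=
  rTensor_smul φ b z

/-- The base change `C ⊗ R → C ⊗_B Q` of a `B`-linear map `q : B ⊗ R → Q`. -/
def quotMap {B : Type*} (C : Type*) [CommRing B] [CommRing C] [Algebra A B] [Algebra A C]
    [Algebra B C] [IsScalarTower A B C] {Q : Type*} [AddCommGroup Q] [Module B Q]
    (q : B ⊗[A] R →ₗ[B] Q) : C ⊗[A] R →ₗ[C] C ⊗[B] Q :=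
  q.baseChange C ∘ₗ (AlgebraTensorModule.cancelBaseChange A B C C R).symm.toLinearMap

section

variable {B C : Type*} [CommRing B] [CommRing C] [Algebra A B] [Algebra A C]
    [Algebra B C] [IsScalarTower A B C] {Q : Type*} [AddCommGroup Q] [Module B Q]
    (q : B ⊗[A] R →ₗ[B] Q)

theorem quotMap_tmul (c : C) (r : R) : quotMap C q (c ⊗ₜ r) = c ⊗ₜ q (1 ⊗ₜ r) := by
  simp [quotMap]

theorem quotMap_baseMap (z : B ⊗[A] R) :
    quotMap C q (baseMap R (IsScalarTower.toAlgHom A B C) z) = 1 ⊗ₜ q z := by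
  induction z with
  | zero => simp
  | add x y hx hy => simp only [map_add, hx, hy, tmul_add]
  | tmul b r =>
    have h : b ⊗ₜ[A] r = b • ((1 : B) ⊗ₜ[A] r) := by simp [TensorProduct.smul_tmul']
    rw [Algebra.TensorProduct.map_tmul, quotMap_tmul, h, map_smul, tmul_smul, smul_tmul',
      IsScalarTower.toAlgHom_apply, AlgHom.id_apply, Algebra.smul_def, mul_one]

theorem quotMap_surjective (hq : Function.Surjective q) : Function.Surjective (quotMap C q) :=
  (LinearMap.lTensor_surjective C hq).comp (LinearEquiv.surjective _)

/-- Kernels of surjections from `B ⊗ R` are compatible with base change. -/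
theorem ker_quotMap (hq : Function.Surjective q) (I : Ideal (B ⊗[A] R))
    (hI : I.restrictScalars B = LinearMap.ker q) :
    (I.map (baseMap R (IsScalarTower.toAlgHom A B C))).restrictScalars C =
      LinearMap.ker (quotMap C q) := by
  have hmem : ∀ z, z ∈ I ↔ q z = 0 := fun z => by
    rw [← LinearMap.mem_ker, ← hI, Submodule.restrictScalars_mem]
  set J := I.map (baseMap R (IsScalarTower.toAlgHom A B C)) with hJ
  apply le_antisymm
  · intro x hx
    -- `Q` is only a module, so the kernel of `quotMap C q` is not yet known to be an ideal. Proving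
    -- the vanishing for all multiples of `x` makes the induction over the span go through.
    have key : ∀ y, quotMap C q (y * x) = 0 := by
      replace hx : x ∈ J := hx
      rw [hJ, Ideal.map] at hx
      induction hx using Submodule.span_induction with
      | mem x hx =>
        obtain ⟨z, hz, rfl⟩ := hx
        intro y
        induction y with
        | zero => simp
        | add a b ha hb => rw [add_mul, map_add, ha, hb, add_zero]
        | tmul c r =>
          have h : (c ⊗ₜ[A] r) * baseMap R (IsScalarTower.toAlgHom A B C) z =
              c • baseMap R (IsScalarTower.toAlgHom A B C) ((1 ⊗ₜ r) * z) := by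
            rw [map_mul, ← smul_mul_assoc]
            simp [TensorProduct.smul_tmul']
          have h' : (1 ⊗ₜ r) * z ∈ I := I.mul_mem_left _ hz
          rw [h, map_smul, quotMap_baseMap, (hmem _).1 h', tmul_zero, smul_zero]
      | zero => simp
      | add a b _ _ ha hb => intro y; rw [mul_add, map_add, ha, hb, add_zero]
      | smul a x _ hx => intro y; rw [smul_eq_mul, ← mul_assoc]; exact hx _
    simpa using key 1
  -- For the other inclusion, reduction modulo `J` vanishes on `ker q`, hence factors through `q`.
  -- The `C`-linear extension of this factor recovers the class of `y` modulo `J` from `quotMap C q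
  -- y`.
  · let s₀ : B ⊗[A] R →ₗ[B] (C ⊗[A] R) ⧸ J :=
      { toFun := fun z => Ideal.Quotient.mk J (baseMap R (IsScalarTower.toAlgHom A B C) z)
        map_add' := by simp
        map_smul' := fun b z => by
          rw [baseMap_smul, IsScalarTower.toAlgHom_apply, algebraMap_smul]
          rfl }
    have hs₀ : LinearMap.ker q ≤ LinearMap.ker s₀ := fun z hz =>
      Ideal.Quotient.eq_zero_iff_mem.2 (Ideal.mem_map_of_mem _ ((hmem z).2 hz))
    let s₁ : Q →ₗ[B] (C ⊗[A] R) ⧸ J :=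
      (LinearMap.ker q).liftQ s₀ hs₀ ∘ₗ (q.quotKerEquivOfSurjective hq).symm.toLinearMap
    have hs₁ : ∀ z, s₁ (q z) = s₀ z := fun z => by
      have : (q.quotKerEquivOfSurjective hq).symm (q z) = Submodule.Quotient.mk z := by
        rw [LinearEquiv.symm_apply_eq]; rfl
      change (LinearMap.ker q).liftQ s₀ hs₀ ((q.quotKerEquivOfSurjective hq).symm (q z)) = _
      rw [this]; rfl
    have hs : ∀ y : C ⊗[A] R, LinearMap.liftBaseChange C s₁ (quotMap C q y) =
        Ideal.Quotient.mk J y := by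
      intro y
      induction y with
      | zero => simp
      | add x y hx hy => simp only [map_add, hx, hy]
      | tmul c r =>
        rw [quotMap_tmul, LinearMap.liftBaseChange_tmul, hs₁]
        change Ideal.Quotient.mk J (c • baseMap R (IsScalarTower.toAlgHom A B C) (1 ⊗ₜ r)) = _
        simp [TensorProduct.smul_tmul']
    intro y hy
    have h := hs y
    rw [LinearMap.mem_ker.1 hy, map_zero] at h
    exact Ideal.Quotient.eq_zero_iff_mem.1 h.symm

end

variable {F : Type u} [AddCommGroup F] [Module A F]

/-- Surjectivity of the section map can be tested after replacing `B ⊗ R → (B ⊗ R)/I` by any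
surjective linear map with kernel `I`. -/
theorem sectionMap_surjective_iff (β : F →ₗ[A] R) {B : Type u} [CommRing B] [Algebra A B]
    (I : Ideal (B ⊗[A] R)) {W : Type*} [AddCommGroup W] [Module B W] (w : B ⊗[A] R →ₗ[B] W)
    (hw : Function.Surjective w) (hI : I.restrictScalars B = LinearMap.ker w) :
    Function.Surjective (sectionMap β B I) ↔ Function.Surjective (w ∘ₗ β.baseChange B) := by
  have hmem : ∀ x y, Ideal.Quotient.mk I x = Ideal.Quotient.mk I y ↔ w x = w y := fun x y => by
    rw [Ideal.Quotient.eq, ← Submodule.restrictScalars_mem B, hI, LinearMap.mem_ker, map_sub,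
      sub_eq_zero]
  constructor
  · intro h y
    obtain ⟨y, rfl⟩ := hw y
    obtain ⟨z, hz⟩ := h (Ideal.Quotient.mk I y)
    exact ⟨z, (hmem _ _).1 hz⟩
  · intro h y
    obtain ⟨y, rfl⟩ := Ideal.Quotient.mk_surjective y
    obtain ⟨z, hz⟩ := h (w y)
    exact ⟨z, (hmem _ _).2 hz⟩

theorem mk_surjective_and_ker {B : Type*} [CommRing B] [Algebra A B] (I : Ideal (B ⊗[A] R)) :
    Function.Surjective (Ideal.Quotient.mkₐ B I).toLinearMap ∧
      I.restrictScalars B = LinearMap.ker (Ideal.Quotient.mkₐ B I).toLinearMap := by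
  refine ⟨Ideal.Quotient.mkₐ_surjective B I, ?_⟩
  ext x
  exact Ideal.Quotient.eq_zero_iff_mem.symm

/-- Membership in an ideal after localization at one element. -/
theorem mem_map_baseMap_away_iff {B C : Type*} [CommRing B] [CommRing C] [Algebra A B]
    [Algebra A C] [Algebra B C] [IsScalarTower A B C] (f : B) [IsLocalization.Away f C]
    (I : Ideal (B ⊗[A] R)) (z : B ⊗[A] R) :
    baseMap R (IsScalarTower.toAlgHom A B C) z ∈ I.map (baseMap R (IsScalarTower.toAlgHom A B C)) ↔
      ∃ k : ℕ, f ^ k • z ∈ I := by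
  obtain ⟨h1, h2⟩ := mk_surjective_and_ker I
  rw [← Submodule.restrictScalars_mem C, ker_quotMap _ h1 I h2, LinearMap.mem_ker,
    quotMap_baseMap]
  have := IsLocalizedModule.eq_zero_iff (Submonoid.powers f)
    (TensorProduct.mk B C ((B ⊗[A] R) ⧸ I) 1) (m := (Ideal.Quotient.mkₐ B I).toLinearMap z)
  rw [TensorProduct.mk_apply] at this
  rw [this]
  constructor
  · rintro ⟨⟨_, k, rfl⟩, h⟩
    exact ⟨k, Ideal.Quotient.eq_zero_iff_mem.1 h⟩
  · rintro ⟨k, h⟩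
    exact ⟨⟨_, k, rfl⟩, Ideal.Quotient.eq_zero_iff_mem.2 h⟩

theorem exists_baseMap_eq_pow_smul {B C : Type*} [CommRing B] [CommRing C] [Algebra A B]
    [Algebra A C] [Algebra B C] [IsScalarTower A B C] (f : B) [IsLocalization.Away f C]
    (y : C ⊗[A] R) :
    ∃ (k : ℕ) (z : B ⊗[A] R), baseMap R (IsScalarTower.toAlgHom A B C) z =
      algebraMap B C f ^ k • y := by
  induction y with
  | zero => exact ⟨0, 0, by simp⟩
  | tmul c r =>
    obtain ⟨k, b, h⟩ := IsLocalization.Away.surj f c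
    exact ⟨k, b ⊗ₜ r, by simp [TensorProduct.smul_tmul', ← h, mul_comm]⟩
  | add x y hx hy =>
    obtain ⟨k, z, h⟩ := hx
    obtain ⟨k', z', h'⟩ := hy
    refine ⟨k + k', f ^ k' • z + f ^ k • z', ?_⟩
    rw [map_add, baseMap_smul, baseMap_smul, h, h', map_pow, map_pow,
      IsScalarTower.toAlgHom_apply, smul_smul, smul_smul, smul_add, pow_add,
      mul_comm]

end BaseChange

/-! ### Locally free modules of rank `n`. -/

section LocallyFree

theorem IsLocallyFreeOfRank.of_equiv {B : Type*} [CommRing B] {Q : Type*} [AddCommGroup Q]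
    [Module B Q] {n : ℕ} (e : Q ≃ₗ[B] (Fin n → B)) : IsLocallyFreeOfRank B Q n := fun p =>
  ⟨1, p.isPrime.one_notMem, ⟨e.baseChange B (Localization.Away (1 : B)) _ _ ≪≫ₗ
    TensorProduct.piScalarRight _ _ _ _⟩⟩

theorem nonempty_equiv_of_algHom {B : Type*} [CommRing B] {Q : Type*} [AddCommGroup Q]
    [Module B Q] {n : ℕ} {D C : Type*} [CommRing D] [CommRing C] [Algebra B D] [Algebra B C]
    (χ : D →ₐ[B] C) (h : Nonempty (D ⊗[B] Q ≃ₗ[D] (Fin n → D))) :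
    Nonempty (C ⊗[B] Q ≃ₗ[C] (Fin n → C)) := by
  let _ : Algebra D C := χ.toRingHom.toAlgebra
  have : IsScalarTower B D C := IsScalarTower.of_algebraMap_eq fun r => (χ.commutes r).symm
  obtain ⟨g⟩ := h
  exact ⟨(AlgebraTensorModule.cancelBaseChange B D C C Q).symm ≪≫ₗ
    g.baseChange D C _ _ ≪≫ₗ TensorProduct.piScalarRight _ _ _ _⟩

/-- Local freeness can be tested on an open covering. -/
theorem IsLocallyFreeOfRank.of_away {B : Type*} [CommRing B] {Q : Type*} [AddCommGroup Q]
    [Module B Q] {n : ℕ}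
    (h : ∀ p : PrimeSpectrum B, ∃ f : B, f ∉ p.asIdeal ∧
      IsLocallyFreeOfRank (Localization.Away f) (Localization.Away f ⊗[B] Q) n) :
    IsLocallyFreeOfRank B Q n := by
  intro p
  obtain ⟨f, hf, h⟩ := h p
  have hp : p ∈ Set.range (PrimeSpectrum.comap (algebraMap B (Localization.Away f))) := by
    rw [PrimeSpectrum.localization_away_comap_range (Localization.Away f) f]
    exact hf
  obtain ⟨q, rfl⟩ := hp
  obtain ⟨g, hg, hfree⟩ := h q
  obtain ⟨k, b, hb⟩ := IsLocalization.Away.surj f g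
  have hu : IsUnit (algebraMap B (Localization.Away f) f ^ k) :=
    IsLocalization.Away.algebraMap_pow_isUnit f k
  -- `b` is `g` times a power of the unit `f` of `B_f`, so `D(f b)` in `Spec B` is the open set
  -- `D(g)` of `Spec B_f`.
  refine ⟨f * b, ?_, ?_⟩
  · intro hmem
    rcases (PrimeSpectrum.comap (algebraMap B (Localization.Away f)) q).isPrime.mem_or_mem hmem
      with h1 | h1
    · exact hf h1
    · have h2 : algebraMap B (Localization.Away f) b ∈ q.asIdeal := h1
      rw [← hb] at h2
      rcases q.isPrime.mem_or_mem h2 with h3 | h3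
      · exact hg h3
      · exact q.isPrime.ne_top (Ideal.eq_top_of_isUnit_mem _ h3 hu)
  · have hfb : IsUnit (algebraMap B (Localization.Away (f * b)) (f * b)) :=
      IsLocalization.Away.algebraMap_isUnit _
    rw [map_mul] at hfb
    let χ : Localization.Away f →ₐ[B] Localization.Away (f * b) :=
      IsLocalization.Away.liftAlgHom f (f := Algebra.ofId B _) (isUnit_of_mul_isUnit_left hfb)
    let _ : Algebra (Localization.Away f) (Localization.Away (f * b)) := χ.toRingHom.toAlgebra
    have : IsScalarTower B (Localization.Away f) (Localization.Away (f * b)) :=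
      IsScalarTower.of_algebraMap_eq fun r => (χ.commutes r).symm
    have hχg : IsUnit (algebraMap (Localization.Away f) (Localization.Away (f * b)) g) := by
      have h1 : IsUnit (algebraMap (Localization.Away f) (Localization.Away (f * b))
          (g * algebraMap B (Localization.Away f) f ^ k)) := by
        rw [hb, ← IsScalarTower.algebraMap_apply]
        exact isUnit_of_mul_isUnit_right hfb
      rw [map_mul] at h1
      exact isUnit_of_mul_isUnit_left h1
    let χ' : Localization.Away g →ₐ[Localization.Away f] Localization.Away (f * b) :=
      IsLocalization.Away.liftAlgHom g (f := Algebra.ofId _ _) hχg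
    obtain ⟨e⟩ := nonempty_equiv_of_algHom χ' hfree
    exact ⟨(AlgebraTensorModule.cancelBaseChange B (Localization.Away f)
      (Localization.Away (f * b)) (Localization.Away (f * b)) Q).symm ≪≫ₗ e⟩

theorem IsLocallyFreeOfRank.finite {B : Type*} [CommRing B] {Q : Type*} [AddCommGroup Q]
    [Module B Q] {n : ℕ} (h : IsLocallyFreeOfRank B Q n) : Module.Finite B Q := by
  choose f hf e using h
  have hspan : Ideal.span (Set.range f) = ⊤ := by
    by_contra hne
    obtain ⟨m, hm, hle⟩ := Ideal.exists_le_maximal _ hne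
    exact hf ⟨m, hm.isPrime⟩ (hle (Ideal.subset_span ⟨_, rfl⟩))
  refine Module.Finite.of_localizationSpan' _ hspan
    (Mₚ := fun r => Localization.Away r.1 ⊗[B] Q)
    (Rₚ := fun r => Localization.Away r.1)
    (fun r => TensorProduct.mk B (Localization.Away r.1) Q 1) ?_
  rintro ⟨_, p, rfl⟩
  exact Module.Finite.equiv (e p).some.symm

/-- A surjection from a free module of rank `n` to a locally free module of rank `n` is
bijective. -/
theorem IsLocallyFreeOfRank.bijective {B : Type*} [CommRing B] {Q P : Type*} [AddCommGroup Q]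
    [Module B Q] [AddCommGroup P] [Module B P] {n : ℕ} (h : IsLocallyFreeOfRank B Q n)
    (b : P ≃ₗ[B] (Fin n → B)) (g : P →ₗ[B] Q) (hg : Function.Surjective g) :
    Function.Bijective g := by
  refine ⟨(injective_iff_map_eq_zero g).2 fun x hx => ?_, hg⟩
  by_contra hx0
  -- The annihilator of a nonzero `x` in the kernel lies in a maximal ideal `m`. On some `D(f)`
  -- around `m` both modules are free of rank `n`, where a surjective endomorphism is injective. So
  -- a power of `f` kills `x`, contradicting `f ∉ m`.
  have hann : (LinearMap.toSpanSingleton B P x).ker ≠ ⊤ := fun ht => hx0 <| by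
    have : (1 : B) ∈ (LinearMap.toSpanSingleton B P x).ker := by rw [ht]; trivial
    simpa using this
  obtain ⟨m, hm, hle⟩ := Ideal.exists_le_maximal _ hann
  obtain ⟨f, hf, ⟨e⟩⟩ := h ⟨m, hm.isPrime⟩
  let L := Localization.Away f
  let b' : (L ⊗[B] P) ≃ₗ[L] (Fin n → L) :=
    b.baseChange B L _ _ ≪≫ₗ TensorProduct.piScalarRight _ _ _ _
  have hs : Function.Surjective
      (e.toLinearMap ∘ₗ g.baseChange L ∘ₗ b'.symm.toLinearMap) :=
    e.surjective.comp ((LinearMap.lTensor_surjective L hg).comp b'.symm.surjective)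
  have hi := OrzechProperty.injective_of_surjective_endomorphism _ hs
  have hx1 : (1 : L) ⊗ₜ[B] x = 0 := by
    apply b'.injective
    apply hi
    simp [hx]
  have := (IsLocalizedModule.eq_zero_iff (Submonoid.powers f) (TensorProduct.mk B L P 1)
    (m := x)).1 hx1
  obtain ⟨⟨_, k, rfl⟩, hk⟩ := this
  replace hk : f ^ k • x = 0 := hk
  exact hf (hm.isPrime.mem_of_pow_mem k (hle (by
    rw [LinearMap.mem_ker, LinearMap.toSpanSingleton_apply, hk])))

end LocallyFree

/-! ### Coordinates in `B ⊗ E` and ideals of zeroes. -/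

section Contraction

variable {A : Type*} [CommRing A] {E : Type*} [AddCommGroup E] [Module A E]

/-- The contraction `B ⊗ E → B` with a linear form on `E`. -/
def contract (B : Type*) [CommRing B] [Algebra A B] (ξ : Module.Dual A E) : B ⊗[A] E →ₗ[B] B :=
  ξ.baseChange B

theorem contract_tmul {B : Type*} [CommRing B] [Algebra A B] (ξ : Module.Dual A E) (b : B) (w : E) :
    contract B ξ (b ⊗ₜ w) = ξ w • b :=
  Module.Dual.baseChange_apply_tmul _ ξ b w

theorem map_contract {B C : Type*} [CommRing B] [Algebra A B] [CommRing C] [Algebra A C]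
    (φ : B →ₐ[A] C) (ξ : Module.Dual A E) (y : B ⊗[A] E) :
    φ (contract B ξ y) = contract C ξ (φ.toLinearMap.rTensor E y) := by
  induction y with
  | zero => simp
  | add x y hx hy => simp only [map_add, hx, hy]
  | tmul b w => simp [contract_tmul]

theorem eq_sum_contract {ι : Type*} [Fintype ι] (b : Module.Basis ι A E)
    {B : Type*} [CommRing B] [Algebra A B] (y : B ⊗[A] E) :
    y = ∑ i, contract B (b.coord i) y • ((1 : B) ⊗ₜ[A] b i) := by
  induction y with
  | zero => simp
  | add x y hx hy => simp only [map_add, add_smul, Finset.sum_add_distrib]; rw [← hx, ← hy]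
  | tmul c w =>
    simp only [contract_tmul, TensorProduct.smul_tmul', smul_eq_mul, mul_one]
    simp only [TensorProduct.smul_tmul, ← tmul_sum]
    simp [b.sum_repr]

theorem ext_contract [Module.Free A E] [Module.Finite A E] {B : Type*} [CommRing B] [Algebra A B]
    {y z : B ⊗[A] E} (h : ∀ ξ, contract B ξ y = contract B ξ z) : y = z := by
  rw [eq_sum_contract (Module.Free.chooseBasis A E) y,
    eq_sum_contract (Module.Free.chooseBasis A E) z]
  simp only [h]

/-- The ideal of zeroes of `u : N → B ⊗ E` is killed by `φ : B → C` as soon as `u` composed with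
`B ⊗ E → C ⊗ E` is zero. -/
theorem zeroIdeal_le_ker [Module.Free A E] [Module.Finite A E] {B C : Type*} [CommRing B]
    [CommRing C] [Algebra A B] [Algebra A C] (φ : B →ₐ[A] C) {N : Type*} [AddCommGroup N]
    [Module B N] (u : N →ₗ[B] B ⊗[A] E) (h : ∀ x, φ.toLinearMap.rTensor E (u x) = 0) :
    zeroIdeal u ≤ RingHom.ker φ := by
  rintro _ ⟨z, rfl⟩
  rw [RingHom.mem_ker]
  induction z with
  | zero => simp
  | add x y hx hy => rw [map_add, map_add, hx, hy, add_zero]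
  | tmul x ξ =>
    rw [LinearMap.comp_apply, LinearMap.rTensor_tmul, contractRight_apply,
      eq_sum_contract (Module.Free.chooseBasis A E) (u x), map_sum, map_sum]
    refine Finset.sum_eq_zero fun i _ => ?_
    rw [map_smul, smul_eq_mul, map_mul, map_contract, h, map_zero, zero_mul]

end Contraction

/-! ### Base change of endomorphism algebras. -/

section EndBaseChange

variable {A : Type*} [CommRing A] {F : Type*} [AddCommGroup F] [Module A F]

/-- The homomorphism `B ⊗ End_A(F) → End_B(B ⊗ F)`. -/
def endHom (B : Type*) [CommRing B] [Algebra A B] :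
    B ⊗[A] Module.End A F →ₐ[B] Module.End B (B ⊗[A] F) :=
  Algebra.TensorProduct.lift (Algebra.ofId B (Module.End B (B ⊗[A] F)))
    (Module.End.baseChangeHom A B F) fun c x =>
      (Algebra.commute_algebraMap_left c (Module.End.baseChangeHom A B F x) :)

theorem endHom_tmul {B : Type*} [CommRing B] [Algebra A B] (b c : B) (w : Module.End A F) (f : F) :
    endHom B (b ⊗ₜ w) (c ⊗ₜ f) = (b * c) ⊗ₜ w f :=
  LinearMap.congr_fun (Algebra.TensorProduct.lift_tmul _ _ _ b w) (c ⊗ₜ f)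

/-- The elementary endomorphisms for a basis of `F` are carried to those for the base-changed basis.
-/
theorem endHom_bijective [Module.Free A F] [Module.Finite A F] (B : Type*) [CommRing B]
    [Algebra A B] : Function.Bijective (endHom (A := A) (F := F) B) := by
  classical
  let b := Module.Free.chooseBasis A F
  let b₁ := b.end.baseChange B
  let b₂ := (b.baseChange B).end
  have h : (endHom (A := A) (F := F) B).toLinearMap = (b₁.equiv b₂ (Equiv.refl _)).toLinearMap := by
    refine b₁.ext fun ij => ?_
    refine (b.baseChange B).ext fun k => ?_
    simp only [b₁, b₂, LinearEquiv.coe_coe, Module.Basis.equiv_apply, Equiv.refl_apply]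
    rw [Module.Basis.end_apply_apply]
    simp only [Module.Basis.baseChange_apply, AlgHom.toLinearMap_apply, endHom_tmul]
    rw [Module.Basis.end_apply_apply]
    split_ifs <;> simp
  have h' : ⇑(endHom (A := A) (F := F) B) = b₁.equiv b₂ (Equiv.refl _) := by
    funext x; exact LinearMap.congr_fun h x
  rw [h']
  exact LinearEquiv.bijective _

theorem evalAt_baseChange {A : Type u} [CommRing A] {F : Type u} [AddCommGroup F] [Module A F]
    {B : Type*} [CommRing B] [Algebra A B] (e : F) (y : B ⊗[A] Module.End A F) :
    (evalAt e).baseChange B y = endHom B y (1 ⊗ₜ e) := by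
  induction y with
  | zero => simp
  | add x y hx hy => simp only [map_add, hx, hy, LinearMap.add_apply]
  | tmul b w => rw [endHom_tmul, mul_one]; rfl

end EndBaseChange

/-! ### Families `r ↦ μ(r)(e)` attached to homomorphisms `μ : R → B ⊗ End(F)`. -/

section Family

variable {A : Type u} [CommRing A] {R F : Type u} [CommRing R] [Algebra A R] [AddCommGroup F]
  [Module A F] {B C : Type u} [CommRing B] [Algebra A B] [CommRing C] [Algebra A C]

/-- The linear map `B ⊗ R → B ⊗ F`, `r ↦ μ(r)(e)`, attached to a homomorphism
`μ : R → B ⊗ End_A(F)`. -/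
def family (e : F) (μ : R →ₐ[A] B ⊗[A] Module.End A F) : B ⊗[A] R →ₗ[B] B ⊗[A] F :=
  (evalAt e).baseChange B ∘ₗ (algLift μ).toLinearMap

theorem family_apply (e : F) (μ : R →ₐ[A] B ⊗[A] Module.End A F) (z : B ⊗[A] R) :
    family e μ z = endHom B (algLift μ z) (1 ⊗ₜ e) :=
  evalAt_baseChange _ _

/-- This is what makes the kernel of a family an ideal, although the family itself is only linear.
-/
theorem family_mul (e : F) (μ : R →ₐ[A] B ⊗[A] Module.End A F) (y z : B ⊗[A] R) :
    family e μ (y * z) = endHom B (algLift μ y) (family e μ z) := by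
  rw [family_apply, family_apply, map_mul, map_mul]
  rfl

/-- The homomorphism `μ : R → B ⊗ End_A(F)` is compatible with the section `β`. -/
def IsCompatible (e : F) (β : F →ₗ[A] R) (μ : R →ₐ[A] B ⊗[A] Module.End A F) : Prop :=
  ∀ f, (evalAt e).baseChange B (μ (β f)) = 1 ⊗ₜ f

theorem IsCompatible.comp_section {e : F} {β : F →ₗ[A] R} {μ : R →ₐ[A] B ⊗[A] Module.End A F}
    (h : IsCompatible e β μ) : family e μ ∘ₗ β.baseChange B = LinearMap.id := by
  refine TensorProduct.AlgebraTensorModule.ext fun b f => ?_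
  change (evalAt e).baseChange B (algLift μ (b ⊗ₜ β f)) = b ⊗ₜ f
  rw [algLift_tmul, map_smul, h f, smul_tmul', smul_eq_mul, mul_one]

theorem IsCompatible.isSectionHom {e : F} {β : F →ₗ[A] R} {μ : R →ₐ[A] B ⊗[A] Module.End A F}
    (h : IsCompatible e β μ) : IsSectionHom e β (family e μ) where
  surjective y := ⟨β.baseChange B y, LinearMap.congr_fun h.comp_section y⟩
  ker_isIdeal := ⟨
    { carrier := {z | family e μ z = 0}
      add_mem' := fun {x y} hx hy => by
        rw [Set.mem_ofPred_eq] at *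
        rw [map_add, hx, hy, add_zero]
      zero_mem' := map_zero _
      smul_mem' := fun y z hz => by
        rw [Set.mem_ofPred_eq] at *
        rw [smul_eq_mul, family_mul, hz, map_zero] }, rfl⟩
  map_one := by
    rw [family_apply, ← Algebra.TensorProduct.one_def, map_one, map_one]
    rfl
  comp_section := h.comp_section

/-- A homomorphism compatible with `β` is determined by its family. -/
theorem IsCompatible.endHom_apply {e : F} {β : F →ₗ[A] R} {μ : R →ₐ[A] B ⊗[A] Module.End A F}
    (h : IsCompatible e β μ) (z : B ⊗[A] R) (x : B ⊗[A] F) :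
    endHom B (algLift μ z) x = family e μ (z * β.baseChange B x) := by
  rw [family_mul]
  congr 1
  exact (LinearMap.congr_fun h.comp_section x).symm

/-- Both families are split by the same `β`, so each is the projection along its kernel and equal
kernels give equal families. The family in turn determines the action of `μ(r)` on every `x`, as
`μ(r)(x)` is the value of the family at `r β(x)`. -/
theorem IsCompatible.eq_of_ker_eq [Module.Free A F] [Module.Finite A F] {e : F} {β : F →ₗ[A] R}
    {μ ν : R →ₐ[A] B ⊗[A] Module.End A F} (hμ : IsCompatible e β μ) (hν : IsCompatible e β ν)
    (h : LinearMap.ker (family e μ) = LinearMap.ker (family e ν)) : μ = ν := by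
  have hfam : ∀ z, family e μ z = family e ν z := by
    intro z
    have h1 : z - β.baseChange B (family e μ z) ∈ LinearMap.ker (family e μ) := by
      rw [LinearMap.mem_ker, map_sub, sub_eq_zero]
      exact (LinearMap.congr_fun hμ.comp_section _).symm
    rw [h, LinearMap.mem_ker, map_sub, sub_eq_zero] at h1
    exact (h1.trans (LinearMap.congr_fun hν.comp_section _)).symm
  ext r
  have h1 : algLift μ (1 ⊗ₜ r) = algLift ν (1 ⊗ₜ r) := by
    apply (endHom_bijective B).1
    refine LinearMap.ext fun x => ?_
    rw [hμ.endHom_apply, hν.endHom_apply, hfam]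
  simpa [algLift_tmul] using h1

/-- The homomorphism `R → C ⊗ End_A(F)` obtained by base change. -/
abbrev changeBase (φ : B →ₐ[A] C) (μ : R →ₐ[A] B ⊗[A] Module.End A F) :
    R →ₐ[A] C ⊗[A] Module.End A F :=
  (Algebra.TensorProduct.map φ (AlgHom.id A _)).comp μ

theorem evalAt_rTensor (φ : B →ₐ[A] C) (e : F) (y : B ⊗[A] Module.End A F) :
    (evalAt e).baseChange C (Algebra.TensorProduct.map φ (AlgHom.id A _) y) =
      φ.toLinearMap.rTensor F ((evalAt e).baseChange B y) := by
  induction y with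
  | zero => simp
  | add x y hx hy => simp only [map_add, hx, hy]
  | tmul b w => simp

theorem IsCompatible.changeBase {e : F} {β : F →ₗ[A] R} {μ : R →ₐ[A] B ⊗[A] Module.End A F}
    (h : IsCompatible e β μ) (φ : B →ₐ[A] C) : IsCompatible e β (changeBase φ μ) := by
  intro f
  rw [AlgHom.comp_apply, evalAt_rTensor, h f, LinearMap.rTensor_tmul]
  simp

theorem family_changeBase {e : F} [Algebra B C] [IsScalarTower A B C]
    (μ : R →ₐ[A] B ⊗[A] Module.End A F) :
    family e (changeBase (IsScalarTower.toAlgHom A B C) μ) =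
      (AlgebraTensorModule.cancelBaseChange A B C C F).toLinearMap ∘ₗ quotMap C (family e μ) := by
  refine TensorProduct.AlgebraTensorModule.ext fun c r => ?_
  rw [LinearMap.comp_apply, quotMap_tmul]
  change (evalAt e).baseChange C (algLift _ (c ⊗ₜ r)) =
    AlgebraTensorModule.cancelBaseChange A B C C F
      (c ⊗ₜ (evalAt e).baseChange B (algLift μ (1 ⊗ₜ r)))
  rw [algLift_tmul, algLift_tmul, one_smul, map_smul, AlgHom.comp_apply, evalAt_rTensor]
  have h : ∀ y : B ⊗[A] F, c • (IsScalarTower.toAlgHom A B C).toLinearMap.rTensor F y =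
      AlgebraTensorModule.cancelBaseChange A B C C F (c ⊗ₜ y) := by
    intro y
    induction y with
    | zero => simp
    | add x y hx hy => simp only [map_add, tmul_add, smul_add, hx, hy]
    | tmul b f =>
      simp only [LinearMap.rTensor_tmul, AlgebraTensorModule.cancelBaseChange_tmul, smul_tmul',
        Algebra.smul_def]
      rw [mul_comm]
      rfl
  exact h _

/-- Families are compatible with base change. -/
theorem ker_family_changeBase {e : F} (φ : B →ₐ[A] C) (μ : R →ₐ[A] B ⊗[A] Module.End A F)
    (hs : Function.Surjective (family e μ)) (I : Ideal (B ⊗[A] R))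
    (hI : I.restrictScalars B = LinearMap.ker (family e μ)) :
    (I.map (baseMap R φ)).restrictScalars C = LinearMap.ker (family e (changeBase φ μ)) := by
  let _ : Algebra B C := φ.toRingHom.toAlgebra
  have : IsScalarTower A B C := IsScalarTower.of_algebraMap_eq fun r => (φ.commutes r).symm
  have h1 := ker_quotMap (C := C) (family e μ) hs I hI
  have h2 : family e (changeBase φ μ) =
      (AlgebraTensorModule.cancelBaseChange A B C C F).toLinearMap ∘ₗ quotMap C (family e μ) :=
    family_changeBase μ
  rw [h2, LinearEquiv.ker_comp]
  exact h1

end Family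
-- Universal properties of `H`, `H_R` and `H_R^β`.
section UniversalProperty

variable {A : Type u} [CommRing A] {F : Type u} [AddCommGroup F] [Module A F]
  [Module.Free A F] [Module.Finite A F] {M : Type u} [AddCommGroup M] [Module A M]

theorem mu_one_tmul (x : M) : mu A F M (1 ⊗ₜ x) = muAux A F M x := by
  rw [mu, LinearMap.liftBaseChange_tmul, one_smul]

/-- The coordinates of the universal map are the generators of the symmetric algebra, because
contracting the tensor of the identity with `ξ` returns `ξ`. Existence and uniqueness of classifying
homomorphisms both rest on this. -/
theorem contract_muAux (x : M) (ξ : Module.Dual A (Module.End A F)) :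
    contract (SymEnd A F M) ξ (muAux A F M x) = SymmetricAlgebra.ι A _ (x ⊗ₜ ξ) := by
  -- `coevEnd` is not a pure tensor; the formula is proved for every tensor `τ` so that induction
  -- applies.
  have key : ∀ τ : Module.Dual A (Module.End A F) ⊗[A] Module.End A F,
      contract (SymEnd A F M) ξ
        ((SymmetricAlgebra.ι A (M ⊗[A] Module.Dual A (Module.End A F))).rTensor (Module.End A F)
          ((TensorProduct.assoc A M (Module.Dual A (Module.End A F)) (Module.End A F)).symm
            (x ⊗ₜ τ))) =
      SymmetricAlgebra.ι A _ (x ⊗ₜ (ξ ∘ₗ dualTensorHom A _ _ τ)) := by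
    intro τ
    induction τ with
    | zero => simp
    | add a b ha hb => simp only [tmul_add, map_add, ha, hb, LinearMap.comp_add]
    | tmul η w =>
      have h : ξ ∘ₗ dualTensorHom A _ _ (η ⊗ₜ[A] w) = ξ w • η := by
        ext v
        simp [mul_comm]
      rw [TensorProduct.assoc_symm_tmul, LinearMap.rTensor_tmul, contract_tmul, h, tmul_smul,
        map_smul]
  refine (key (coevEnd A F)).trans ?_
  have h : dualTensorHom A _ _ (coevEnd A F) = LinearMap.id := by
    rw [coevEnd]
    exact (dualTensorHomEquiv A (Module.End A F) (Module.End A F)).apply_symm_apply _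
  rw [h, LinearMap.comp_id]

variable {B : Type u} [CommRing B] [Algebra A B]

/-- The homomorphism sends the generator `x ⊗ ξ` to the coordinate `ξ(g(x))`. -/
theorem exists_symEnd_hom (g : M →ₗ[A] B ⊗[A] Module.End A F) :
    ∃ ψ : SymEnd A F M →ₐ[A] B, ∀ x,
      Algebra.TensorProduct.map ψ (AlgHom.id A _) (muAux A F M x) = g x := by
  let l : M ⊗[A] Module.Dual A (Module.End A F) →ₗ[A] B :=
    TensorProduct.lift (LinearMap.mk₂ A (fun x ξ => contract B ξ (g x))
      (fun x y ξ => by rw [map_add, map_add])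
      (fun a x ξ => by rw [map_smul]; exact map_smul ((contract B ξ).restrictScalars A) a (g x))
      (fun x ξ η => by rw [contract, contract, contract, map_add]; rfl)
      (fun a x ξ => by rw [contract, contract, map_smul]; rfl))
  refine ⟨SymmetricAlgebra.lift l, fun x => ext_contract fun ξ => ?_⟩
  have h := map_contract (SymmetricAlgebra.lift l) ξ (muAux A F M x)
  rw [contract_muAux, SymmetricAlgebra.lift_ι_apply] at h
  exact h.symm.trans rfl

theorem symEnd_hom_ext {ψ ψ' : SymEnd A F M →ₐ[A] B}
    (h : ∀ x, Algebra.TensorProduct.map ψ (AlgHom.id A _) (muAux A F M x) =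
      Algebra.TensorProduct.map ψ' (AlgHom.id A _) (muAux A F M x)) : ψ = ψ' := by
  refine SymmetricAlgebra.algHom_ext (TensorProduct.ext' fun x ξ => ?_)
  change ψ (SymmetricAlgebra.ι A _ (x ⊗ₜ ξ)) = ψ' (SymmetricAlgebra.ι A _ (x ⊗ₜ ξ))
  rw [← contract_muAux, map_contract, map_contract]
  exact congrArg _ (h x)

theorem symmetricAlgebra_hom_ext {E : Type*} [Ring E] [Algebra A E]
    {f g : SymmetricAlgebra A M →ₐ[A] E}
    (h : ∀ x, f (SymmetricAlgebra.ι A M x) = g (SymmetricAlgebra.ι A M x)) : f = g := by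
  refine AlgHom.ext fun s => ?_
  induction s using SymmetricAlgebra.induction with
  | algebraMap r => rw [f.commutes, g.commutes]
  | ι x => exact h x
  | mul a b ha hb => rw [map_mul, map_mul, ha, hb]
  | add a b ha hb => rw [map_add, map_add, ha, hb]

theorem muH_ι (x : M) : muH A F M (1 ⊗ₜ SymmetricAlgebra.ι A M x) =
    Algebra.TensorProduct.map (rhoH A F M) (AlgHom.id A _) (muAux A F M x) := by
  rw [muH, algLift_tmul, one_smul]
  refine (symLift_ι _ _ x).trans ?_
  change homMap (rhoH A F M) (mu A F M) (1 ⊗ₜ x) = _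
  rw [homMap, LinearMap.liftBaseChange_tmul, one_smul]
  change (rhoH A F M).toLinearMap.rTensor _ (mu A F M (1 ⊗ₜ x)) = _
  rw [mu_one_tmul]
  rfl

variable {R : Type u} [CommRing R] [Algebra A R] (π : SymmetricAlgebra A M →ₐ[A] R)

/-- The homomorphism classifying `g` on `M` takes the universal commutators to commutators of values
of `g`. These vanish since `Sym(M)` is commutative, so it descends to `H`. -/
theorem exists_algH_hom (g : SymmetricAlgebra A M →ₐ[A] B ⊗[A] Module.End A F) :
    ∃ ψ : AlgH A F M →ₐ[A] B, ∀ s,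
      Algebra.TensorProduct.map ψ (AlgHom.id A _) (muH A F M (1 ⊗ₜ s)) = g s := by
  obtain ⟨ψ₀, h₀⟩ := exists_symEnd_hom (g.toLinearMap ∘ₗ SymmetricAlgebra.ι A M)
  have hle : idealH A F M ≤ RingHom.ker ψ₀ := by
    refine iSup₂_le fun x y => zeroIdeal_le_ker ψ₀ _ fun s => ?_
    rw [LinearMap.toSpanSingleton_apply, rTensor_smul]
    change ψ₀ s • Algebra.TensorProduct.map ψ₀ (AlgHom.id A _) (muCommutator A F M x y) = 0
    rw [muCommutator, mu_one_tmul, mu_one_tmul, map_sub, map_mul, map_mul, h₀, h₀]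
    change _ • (g _ * g _ - g _ * g _) = 0
    rw [← map_mul g, ← map_mul g, mul_comm (SymmetricAlgebra.ι A M x), sub_self, smul_zero]
  let ψ : AlgH A F M →ₐ[A] B := Ideal.Quotient.liftₐ (idealH A F M) ψ₀ hle
  have hψ : ψ.comp (rhoH A F M) = ψ₀ := by ext1; rfl
  refine ⟨ψ, fun s => ?_⟩
  have : ((Algebra.TensorProduct.map ψ (AlgHom.id A _)).comp
      (((muH A F M).restrictScalars A).comp Algebra.TensorProduct.includeRight)) = g := by
    refine symmetricAlgebra_hom_ext fun x => ?_
    change Algebra.TensorProduct.map ψ (AlgHom.id A _)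
      (muH A F M (1 ⊗ₜ SymmetricAlgebra.ι A M x)) = _
    rw [muH_ι, ← AlgHom.comp_apply, ← Algebra.TensorProduct.map_comp, hψ, AlgHom.comp_id, h₀]
    rfl
  exact DFunLike.congr_fun this s

theorem muHR_tmul (hπ : Function.Surjective π) (s : SymmetricAlgebra A M) :
    muHR F π hπ (1 ⊗ₜ π s) =
      Algebra.TensorProduct.map (rhoHR F π) (AlgHom.id A _) (muH A F M (1 ⊗ₜ s)) := by
  rw [muHR, algLift_tmul, one_smul]
  refine (descend_apply π hπ _ _ s).trans ?_
  change homAlgMap (rhoHR F π) (muH A F M) (1 ⊗ₜ s) = _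
  rw [homAlgMap, algLift_tmul, one_smul]
  rfl

/-- The homomorphism classifying `μ ∘ π` kills the ideal of zeroes of `v`, because `μ ∘ π` vanishes
on `ker π`. -/
theorem exists_algHR_hom (hπ : Function.Surjective π) (μ : R →ₐ[A] B ⊗[A] Module.End A F) :
    ∃ ψ : AlgHR F π →ₐ[A] B, ∀ r,
      Algebra.TensorProduct.map ψ (AlgHom.id A _) (muHR F π hπ (1 ⊗ₜ r)) = μ r := by
  obtain ⟨ψ₀, h₀⟩ := exists_algH_hom (μ.comp π)
  have hle : zeroIdeal (vMap F π) ≤ RingHom.ker ψ₀ := by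
    refine zeroIdeal_le_ker ψ₀ _ fun s => ?_
    induction s with
    | zero => simp
    | add x y hx hy => rw [map_add, map_add, hx, hy, add_zero]
    | tmul c s =>
      have h : vMap F π (c ⊗ₜ s) = c • muH A F M (1 ⊗ₜ s.1) := by
        rw [← map_smul, smul_tmul', smul_eq_mul, mul_one]
        rfl
      have hs : π s.1 = 0 := s.2
      rw [h, rTensor_smul]
      change ψ₀ c • Algebra.TensorProduct.map ψ₀ (AlgHom.id A _) _ = 0
      rw [h₀, AlgHom.comp_apply, hs, map_zero, smul_zero]
  let ψ : AlgHR F π →ₐ[A] B := Ideal.Quotient.liftₐ (zeroIdeal (vMap F π)) ψ₀ hle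
  have hψ : ψ.comp (rhoHR F π) = ψ₀ := by ext1; rfl
  refine ⟨ψ, fun r => ?_⟩
  obtain ⟨s, rfl⟩ := hπ r
  rw [muHR_tmul, ← AlgHom.comp_apply, ← Algebra.TensorProduct.map_comp, hψ, AlgHom.comp_id, h₀]
  rfl

variable (hπ : Function.Surjective π) (e : F) (β : F →ₗ[A] R)

/-- The universal homomorphism `R → H_R^β ⊗ End_A(F)`. -/
def univHom : R →ₐ[A] AlgHRSection π hπ e β ⊗[A] Module.End A F :=
  ((Algebra.TensorProduct.map (rhoHRSection π hπ e β) (AlgHom.id A _)).comp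
    ((muHR F π hπ).restrictScalars A)).comp Algebra.TensorProduct.includeRight

theorem univHom_apply (r : R) : univHom π hπ e β r =
    Algebra.TensorProduct.map (rhoHRSection π hπ e β) (AlgHom.id A _) (muHR F π hπ (1 ⊗ₜ r)) := rfl

theorem isCompatible_univHom : IsCompatible e β (univHom π hπ e β) := by
  intro f
  rw [univHom_apply, evalAt_rTensor]
  have h := map_eq_zero_of_zeroIdeal_le (rhoHRSection π hπ e β) (LinearMap.id - uMap π hπ e β)
    (le_of_eq (Ideal.Quotient.mkₐ_ker A (zeroIdeal (LinearMap.id - uMap π hπ e β))).symm) (1 ⊗ₜ f)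
  rw [LinearMap.sub_apply, map_sub, sub_eq_zero, LinearMap.id_apply, LinearMap.rTensor_tmul,
    AlgHom.toLinearMap_apply, map_one] at h
  exact h.symm

/-- Compatibility of `μ` says exactly that `id - u` becomes zero over `B`, so the classifying
homomorphism descends once more. -/
theorem exists_algHRSection_hom {μ : R →ₐ[A] B ⊗[A] Module.End A F} (hμ : IsCompatible e β μ) :
    ∃ ψ : AlgHRSection π hπ e β →ₐ[A] B, changeBase ψ (univHom π hπ e β) = μ := by
  obtain ⟨ψ₀, h₀⟩ := exists_algHR_hom π hπ μ
  have hle : zeroIdeal (LinearMap.id - uMap π hπ e β) ≤ RingHom.ker ψ₀ := by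
    refine zeroIdeal_le_ker ψ₀ _ fun s => ?_
    induction s with
    | zero => simp
    | add x y hx hy => rw [map_add, map_add, hx, hy, add_zero]
    | tmul c f =>
      have h : uMap π hπ e β (c ⊗ₜ f) =
          c • (evalAt e).baseChange _ (muHR F π hπ (1 ⊗ₜ β f)) := by
        rw [← map_smul, ← map_smul, smul_tmul', smul_eq_mul, mul_one]
        rfl
      rw [LinearMap.sub_apply, map_sub, sub_eq_zero, LinearMap.id_apply, h, rTensor_smul, ← evalAt_rTensor,
        h₀, hμ f]
      simp [smul_tmul']
  let ψ : AlgHRSection π hπ e β →ₐ[A] B :=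
    Ideal.Quotient.liftₐ (zeroIdeal (LinearMap.id - uMap π hπ e β)) ψ₀ hle
  have hψ : ψ.comp (rhoHRSection π hπ e β) = ψ₀ := by ext1; rfl
  refine ⟨ψ, AlgHom.ext fun r => ?_⟩
  rw [AlgHom.comp_apply, univHom_apply, ← AlgHom.comp_apply, ← Algebra.TensorProduct.map_comp, hψ,
    AlgHom.comp_id, h₀]

/-- `H_R^β` is a quotient of the symmetric algebra of `M ⊗ End(F)^∨`, and the images of the
generators are the coordinates of the universal homomorphism at the elements `π(x)`, `x ∈ M`. -/
theorem algHRSection_hom_ext {ψ ψ' : AlgHRSection π hπ e β →ₐ[A] B}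
    (h : changeBase ψ (univHom π hπ e β) = changeBase ψ' (univHom π hπ e β)) : ψ = ψ' := by
  let ρ : SymEnd A F M →ₐ[A] AlgHRSection π hπ e β :=
    ((rhoHRSection π hπ e β).comp (rhoHR F π)).comp (rhoH A F M)
  have h₁ : Function.Surjective (rhoHRSection π hπ e β) := Ideal.Quotient.mk_surjective
  have h₂ : Function.Surjective (rhoHR F π) := Ideal.Quotient.mk_surjective
  have h₃ : Function.Surjective (rhoH A F M) := Ideal.Quotient.mk_surjective
  have hρ : Function.Surjective ρ := (h₁.comp h₂).comp h₃
  rw [← AlgHom.cancel_right hρ]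
  refine symEnd_hom_ext fun x => ?_
  have key : univHom π hπ e β (π (SymmetricAlgebra.ι A M x)) =
      Algebra.TensorProduct.map ρ (AlgHom.id A _) (muAux A F M x) := by
    rw [univHom_apply, muHR_tmul, muH_ι, ← AlgHom.comp_apply, ← AlgHom.comp_apply,
      ← Algebra.TensorProduct.map_comp, ← Algebra.TensorProduct.map_comp]
    rfl
  have h1 := DFunLike.congr_fun h (π (SymmetricAlgebra.ι A M x))
  rw [AlgHom.comp_apply, AlgHom.comp_apply, key, ← AlgHom.comp_apply, ← AlgHom.comp_apply,
      ← Algebra.TensorProduct.map_comp, ← Algebra.TensorProduct.map_comp] at h1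
  exact h1

end UniversalProperty

/-! ### Points of the chart of `β` and its representing algebra. -/

section Points

variable {A : Type u} [CommRing A] {R F : Type u} [CommRing R] [Algebra A R] [AddCommGroup F]
  [Module A F] {B C : Type u} [CommRing B] [Algebra A B] [CommRing C] [Algebra A C] {n : ℕ}

/-- A basis of `F` gives an isomorphism `B ⊗ F → Bⁿ`. -/
def baseChangeEquiv (b : Module.Basis (Fin n) A F) (B : Type*) [CommRing B] [Algebra A B] :
    B ⊗[A] F ≃ₗ[B] (Fin n → B) :=
  (b.baseChange B).equivFun

theorem exists_hilbPoint (b : Module.Basis (Fin n) A F) {e : F} {β : F →ₗ[A] R}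
    {u : B ⊗[A] R →ₗ[B] B ⊗[A] F} (h : IsSectionHom e β u) :
    ∃ x : HilbPoint (A := A) R n B, x.IsClassOf u ∧
      Function.Surjective (sectionMap β B x.ideal) := by
  obtain ⟨I, hI⟩ := h.ker_isIdeal
  have e₁ : ((B ⊗[A] R) ⧸ I) ≃ₗ[B] (Fin n → B) :=
    (Submodule.Quotient.restrictScalarsEquiv B I).symm ≪≫ₗ
      Submodule.quotEquivOfEq _ _ hI ≪≫ₗ u.quotKerEquivOfSurjective h.surjective ≪≫ₗ
      baseChangeEquiv b B
  refine ⟨⟨I, .of_equiv e₁⟩, hI, ?_⟩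
  rw [sectionMap_surjective_iff β I u h.surjective hI, h.comp_section]
  exact Function.surjective_id

/-- Every point of the subfunctor attached to `β` is the class of a compatible homomorphism. -/
theorem exists_isCompatible [Module.Free A F] [Module.Finite A F] (b : Module.Basis (Fin n) A F)
    {e : F} {β : F →ₗ[A] R} (hβ : β e = 1)
    (x : HilbPoint (A := A) R n B) (hx : Function.Surjective (sectionMap β B x.ideal)) :
    ∃ μ : R →ₐ[A] B ⊗[A] Module.End A F, IsCompatible e β μ ∧ x.IsClassOf (family e μ) := by
  let σ : B ⊗[A] F ≃ₗ[B] (B ⊗[A] R) ⧸ x.ideal := LinearEquiv.ofBijective (sectionMap β B x.ideal)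
    (x.isLocallyFree.bijective (baseChangeEquiv b B) _ hx)
  have hσ : ∀ f, σ (1 ⊗ₜ f) = Ideal.Quotient.mk x.ideal (1 ⊗ₜ β f) := fun f => rfl
  let θ : B ⊗[A] Module.End A F ≃ₐ[B] Module.End B (B ⊗[A] F) :=
    AlgEquiv.ofBijective (endHom B) (endHom_bijective B)
  -- Multiplication on `Q`, transported to `B ⊗ F` along `σ`.
  let μ' : B ⊗[A] R →ₐ[B] B ⊗[A] Module.End A F :=
    (θ.symm.toAlgHom.comp (σ.symm.conjAlgEquiv B).toAlgHom).comp
      ((Algebra.lmul B ((B ⊗[A] R) ⧸ x.ideal)).comp (Ideal.Quotient.mkₐ B x.ideal))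
  have hμ' : ∀ z y, endHom B (μ' z) y = σ.symm (Ideal.Quotient.mk x.ideal z * σ y) := by
    intro z y
    have : endHom B (μ' z) = σ.symm.conjAlgEquiv B
      (Algebra.lmul B ((B ⊗[A] R) ⧸ x.ideal) (Ideal.Quotient.mk x.ideal z)) :=
      θ.apply_symm_apply _
    rw [this]
    rfl
  let μ : R →ₐ[A] B ⊗[A] Module.End A F :=
    (μ'.restrictScalars A).comp Algebra.TensorProduct.includeRight
  have hμ : algLift μ = μ' := by
    refine AlgHom.ext fun z => ?_
    induction z with
    | zero => simp
    | add x y hx hy => rw [map_add, map_add, hx, hy]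
    | tmul b r =>
      rw [algLift_tmul]
      change b • μ' (1 ⊗ₜ r) = _
      rw [← map_smul, smul_tmul', smul_eq_mul, mul_one]
  -- The one place where `β(e) = 1` enters: evaluating at `e` now means multiplying by `1`, so the
  -- family of `μ` is the residue map followed by `σ⁻¹`.
  have hone : σ (1 ⊗ₜ e) = 1 := by
    rw [hσ, hβ, ← Algebra.TensorProduct.one_def, map_one]
  refine ⟨μ, fun f => ?_, ?_⟩
  · rw [evalAt_baseChange]
    change endHom B (μ' (1 ⊗ₜ β f)) _ = _
    rw [hμ', hone, mul_one, ← hσ, σ.symm_apply_apply]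
  · rw [HilbPoint.IsClassOf]
    ext z
    rw [LinearMap.mem_ker, family_apply, hμ, hμ', hone, mul_one, σ.symm.map_eq_zero_iff,
      Ideal.Quotient.eq_zero_iff_mem, Submodule.restrictScalars_mem]

theorem hilbPoint_ext_of_isClassOf {x y : HilbPoint (A := A) R n B}
    {u : B ⊗[A] R →ₗ[B] B ⊗[A] F} (hx : x.IsClassOf u) (hy : y.IsClassOf u) : x = y :=
  HilbPoint.ext (Submodule.restrictScalars_injective B _ _ (hx.trans hy.symm))

theorem HilbPoint.IsClassOf.map {x : HilbPoint (A := A) R n B} {e : F}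
    {μ : R →ₐ[A] B ⊗[A] Module.End A F} (hx : x.IsClassOf (family e μ))
    (hs : Function.Surjective (family e μ)) (φ : B →ₐ[A] C) :
    (x.map φ).IsClassOf (family e (changeBase φ μ)) :=
  ker_family_changeBase φ μ hs x.ideal hx

variable [Module.Free A F] [Module.Finite A F] {M : Type u} [AddCommGroup M] [Module A M]
  (π : SymmetricAlgebra A M →ₐ[A] R) (hπ : Function.Surjective π) {e : F} {β : F →ₗ[A] R}

/-- The algebra `H_R^β` represents the subfunctor of the Hilbert functor attached to `β`. -/
theorem exists_iso_hilbSection (b : Module.Basis (Fin n) A F) (hβ : β e = 1) :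
    ∃ Φ : coyoneda.obj (Opposite.op (CommAlgCat.of A (AlgHRSection π hπ e β))) ≅
        (hilbSection n β).toFunctor,
      HilbPoint.IsClassOf
        (Φ.hom.app (CommAlgCat.of A (AlgHRSection π hπ e β)) (𝟙 _)).1
        (universalFamily π hπ e β) := by
  have hu := isCompatible_univHom π hπ e β
  obtain ⟨x, hx, hxs⟩ := exists_hilbPoint b hu.isSectionHom
  let K := CommAlgCat.of A (AlgHRSection π hπ e β)
  let x₀ : (hilbSection n β).toFunctor.obj K := ⟨x, hxs⟩
  -- By Yoneda, the class `x₀` of the universal family determines the transformation. Bijectivity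
  -- then follows from uniqueness and existence of classifying homomorphisms.
  let Ψ : coyoneda.obj (Opposite.op K) ⟶ (hilbSection n β).toFunctor := coyonedaEquiv.symm x₀
  have hΨ : ∀ (B : CommAlgCat.{u} A) (ψ : K ⟶ B), (Ψ.app B ψ).1.IsClassOf
      (family e (changeBase ψ.hom (univHom π hπ e β))) := fun B ψ =>
    hx.map hu.isSectionHom.surjective ψ.hom
  have hbij : ∀ B, Function.Bijective (Ψ.app B) := by
    intro B
    constructor
    · intro ψ ψ' h
      have h1 := hΨ B ψ
      rw [h] at h1
      exact CommAlgCat.hom_ext (algHRSection_hom_ext π hπ e β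
        ((hu.changeBase _).eq_of_ker_eq (hu.changeBase _) (h1.symm.trans (hΨ B ψ'))))
    · rintro ⟨y, hy⟩
      obtain ⟨μ, hμ, hyμ⟩ := exists_isCompatible b hβ y hy
      obtain ⟨ψ, rfl⟩ := exists_algHRSection_hom π hπ e β hμ
      exact ⟨CommAlgCat.ofHom ψ, Subtype.ext
        (hilbPoint_ext_of_isClassOf (hΨ B (CommAlgCat.ofHom ψ)) hyμ)⟩
  have : ∀ B, IsIso (Ψ.app B) := fun B => (isIso_iff_bijective _).2 (hbij B)
  have : IsIso Ψ := NatIso.isIso_of_isIso_app Ψ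
  refine ⟨asIso Ψ, ?_⟩
  have h := hΨ K (𝟙 K)
  have h' : changeBase (AlgHom.id A _) (univHom π hπ e β) = univHom π hπ e β := by
    rw [changeBase, Algebra.TensorProduct.map_id, AlgHom.id_comp]
  change (Ψ.app K (𝟙 K)).1.IsClassOf
      (family e (changeBase (AlgHom.id A _) (univHom π hπ e β))) at h
  rw [h'] at h
  exact h

end Points

/-! ### The charts form an open covering. -/

section Covering

/-- The tensor product is right exact, so the formation of cokernels commutes with base change. -/
theorem baseChange_surjective_iff {B : Type*} [CommRing B] {P Q : Type*} [AddCommGroup P]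
    [Module B P] [AddCommGroup Q] [Module B Q] (σ : P →ₗ[B] Q) (C : Type*) [CommRing C]
    [Algebra B C] : Function.Surjective (σ.baseChange C) ↔
      Subsingleton (C ⊗[B] (Q ⧸ LinearMap.range σ)) := by
  have hex : Function.Exact σ (LinearMap.range σ).mkQ := by
    rw [LinearMap.exact_iff, Submodule.ker_mkQ]
  have h := lTensor_exact C hex (Submodule.mkQ_surjective _)
  have hs := LinearMap.lTensor_surjective C (Submodule.mkQ_surjective (LinearMap.range σ))
  constructor
  · intro hσ
    refine ⟨fun a b => ?_⟩
    have hz : ∀ a : C ⊗[B] (Q ⧸ LinearMap.range σ), a = 0 := fun a => by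
      obtain ⟨q, rfl⟩ := hs a
      exact (h q).2 (hσ q)
    rw [hz a, hz b]
  · intro hsub q
    exact (h q).1 (Subsingleton.elim _ _)

/-- A nonzero fibre of `N` at a prime of `B` stays nonzero over the residue field of any prime of
`C` above it. Conversely, if `C ⊗ N` were nonzero, a maximal ideal containing its annihilator would
lie over a prime outside the support. As `N` is finite, some element of its annihilator avoids that
prime, a contradiction. -/
theorem subsingleton_tensor_iff {B : Type u} [CommRing B] (N : Type u) [AddCommGroup N]
    [Module B N] [Module.Finite B N] (C : Type u) [CommRing C] [Algebra B C] :
    Subsingleton (C ⊗[B] N) ↔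
      Set.range (PrimeSpectrum.comap (algebraMap B C)) ⊆ (Module.support B N)ᶜ := by
  constructor
  · rintro hsub _ ⟨q, rfl⟩ hq
    rw [Module.mem_support_iff_nontrivial_residueField_tensorProduct] at hq
    let p := PrimeSpectrum.comap (algebraMap B C) q
    let k := p.asIdeal.ResidueField
    let K := q.asIdeal.ResidueField
    let _ : Algebra k K := (Ideal.ResidueField.map p.asIdeal q.asIdeal (algebraMap B C) rfl).toAlgebra
    have : IsScalarTower B k K := IsScalarTower.of_algebraMap_eq fun r =>
      (Ideal.ResidueField.map_algebraMap p.asIdeal q.asIdeal (algebraMap B C) rfl r).symm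
    have h1 : Nontrivial (K ⊗[k] (k ⊗[B] N)) := inferInstance
    have h2 : Nontrivial (K ⊗[B] N) :=
      (AlgebraTensorModule.cancelBaseChange B k K K N).symm.nontrivial
    have h3 : Subsingleton (K ⊗[C] (C ⊗[B] N)) := inferInstance
    have h4 : Subsingleton (K ⊗[B] N) :=
      (AlgebraTensorModule.cancelBaseChange B C K K N).symm.subsingleton
    exact not_subsingleton _ h4
  · intro h
    have hann : Module.annihilator C (C ⊗[B] N) = ⊤ := by
      by_contra hne
      obtain ⟨m, hm, hle⟩ := Ideal.exists_le_maximal _ hne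
      have h1 : PrimeSpectrum.comap (algebraMap B C) ⟨m, hm.isPrime⟩ ∉ Module.support B N :=
        h ⟨_, rfl⟩
      rw [Module.mem_support_iff_of_finite] at h1
      obtain ⟨f, hf, hfm⟩ := SetLike.not_le_iff_exists.1 h1
      refine hfm (hle (?_ : algebraMap B C f ∈ _))
      rw [Module.mem_annihilator]
      intro z
      induction z with
      | zero => simp
      | add x y hx hy => rw [smul_add, hx, hy, add_zero]
      | tmul c y =>
        rw [algebraMap_smul, ← tmul_smul, Module.mem_annihilator.1 hf, tmul_zero]
    rwa [Module.annihilator_eq_top_iff] at hann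

variable {A : Type u} [CommRing A] {R F : Type u} [CommRing R] [Algebra A R] [AddCommGroup F]
  [Module A F] {n : ℕ}

/-- The open set is the complement of the support of the cokernel of `B ⊗ F → Q`, which is closed
because `Q`, being locally free of finite rank, is finite. -/
theorem isOpenSubfunctor_hilbSection (β : F →ₗ[A] R) :
    IsOpenSubfunctor (hilbSection n β) := by
  intro B x
  let y : HilbPoint (A := A) R n B := x
  let Q := (B ⊗[A] R) ⧸ y.ideal
  let q : B ⊗[A] R →ₗ[B] Q := (Ideal.Quotient.mkₐ B y.ideal).toLinearMap
  let N := Q ⧸ LinearMap.range (sectionMap β B y.ideal)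
  have : Module.Finite B Q := y.isLocallyFree.finite
  have : Module.Finite B N := inferInstance
  refine ⟨⟨(Module.support B N)ᶜ, (Module.isClosed_support).isOpen_compl⟩, fun C φ => ?_⟩
  let _ : Algebra B C := φ.hom.toRingHom.toAlgebra
  have : IsScalarTower A B C := IsScalarTower.of_algebraMap_eq fun r => (φ.hom.commutes r).symm
  obtain ⟨h1, h2⟩ := mk_surjective_and_ker y.ideal
  have h3 : (hilb A R n).map φ x ∈ (hilbSection n β).obj C ↔
      Function.Surjective (quotMap C q ∘ₗ β.baseChange C) :=
    sectionMap_surjective_iff β (y.ideal.map (baseMap R φ.hom)) (quotMap C q)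
      (quotMap_surjective q h1) (ker_quotMap q h1 y.ideal h2)
  have h4 : quotMap C q ∘ₗ β.baseChange C = (sectionMap β B y.ideal).baseChange C ∘ₗ
      (AlgebraTensorModule.cancelBaseChange A B C C F).symm.toLinearMap := by
    refine TensorProduct.AlgebraTensorModule.ext fun c f => ?_
    simp [quotMap_tmul, sectionMap, q]
  rw [h3, h4, LinearMap.coe_comp, LinearEquiv.coe_coe, EquivLike.surjective_comp,
    baseChange_surjective_iff, subsingleton_tensor_iff]
  rfl

/-- The images of elements of `R` span `Q` over `K`, and `1 ≠ 0` in `Q` because the dimension `n` is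
positive. Hence `1` extends to a basis of such images, and `β` sends the basis of `F` to lifts of
it. -/
theorem exists_surjective_sectionMap_of_field {K : Type u} [Field K] [Algebra A K]
    (b : Module.Basis (Fin n) A F) (i : Fin n) (x : HilbPoint (A := A) R n K) :
    ∃ β : F →ₗ[A] R, β (b i) = 1 ∧ Function.Surjective (sectionMap β K x.ideal) := by
  classical
  let Q := (K ⊗[A] R) ⧸ x.ideal
  have hQ : Nonempty (Q ≃ₗ[K] (Fin n → K)) := by
    obtain ⟨f, hf, he⟩ := x.isLocallyFree ⊥
    have hf' : IsUnit (Algebra.ofId K K f) := isUnit_iff_ne_zero.2 fun h => hf (by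
      rw [show f = 0 from h]; exact zero_mem _)
    obtain ⟨g⟩ := nonempty_equiv_of_algHom
      (IsLocalization.Away.liftAlgHom f hf' : Localization.Away f →ₐ[K] K) he
    exact ⟨(TensorProduct.lid K Q).symm ≪≫ₗ g⟩
  obtain ⟨eQ⟩ := hQ
  have : Module.Finite K Q := Module.Finite.equiv eQ.symm
  have hrank : Module.finrank K Q = n := by rw [eQ.finrank_eq, Module.finrank_fin_fun]
  have : Nontrivial Q := Module.nontrivial_of_finrank_pos (R := K) (by
    rw [hrank]; exact i.pos)
  let v : R → Q := fun r => Ideal.Quotient.mk x.ideal (1 ⊗ₜ r)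
  have hv1 : v 1 = 1 := map_one (Ideal.Quotient.mk x.ideal)
  have hspan : Submodule.span K (Set.range v) = ⊤ := by
    rw [eq_top_iff]
    rintro q -
    obtain ⟨z, rfl⟩ := Ideal.Quotient.mk_surjective q
    induction z with
    | zero => rw [map_zero]; exact zero_mem _
    | add x y hx hy => rw [map_add]; exact add_mem hx hy
    | tmul c r =>
      have : Ideal.Quotient.mk x.ideal (c ⊗ₜ[A] r) = c • v r := by
        change _ = Ideal.Quotient.mk x.ideal (c • ((1 : K) ⊗ₜ[A] r))
        rw [smul_tmul', smul_eq_mul, mul_one]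
      rw [this]
      exact Submodule.smul_mem _ _ (Submodule.subset_span ⟨r, rfl⟩)
  obtain ⟨s, hsv, h1s, hvs, hlin⟩ := exists_linearIndepOn_id_extension
    (linearIndepOn_singleton_iff K |>.2 (one_ne_zero : (1 : Q) ≠ 0))
    (Set.singleton_subset_iff.2 ⟨1, hv1⟩ : ({1} : Set Q) ⊆ Set.range v)
  have hs : ⊤ ≤ Submodule.span K (Set.range ((↑) : s → Q)) := by
    rw [Subtype.range_coe, ← hspan]
    exact Submodule.span_le.2 hvs
  let bs : Module.Basis s K Q := Module.Basis.mk hlin hs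
  let e₀ : s ≃ Fin n := bs.indexEquiv (Module.finBasisOfFinrankEq K Q hrank)
  let one' : s := ⟨1, h1s rfl⟩
  -- The swap gives the basis vector `1` the index `i` of the distinguished element.
  let e₁ : s ≃ Fin n := e₀.trans (Equiv.swap (e₀ one') i)
  have he₁ : e₁.symm i = one' := by
    rw [Equiv.symm_apply_eq]
    simp [e₁]
  -- The lift of `1` must be `1` itself, not just some element with image `1`, so that `β(b i) = 1`
  -- holds in `R`.
  have hr : ∀ q : s, ∃ r : R, v r = q.1 ∧ (q = one' → r = 1) := by
    intro q
    by_cases hq : q = one'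
    · exact ⟨1, by rw [hv1, hq], fun _ => rfl⟩
    · obtain ⟨r, hr⟩ := hsv q.2
      exact ⟨r, hr, fun h => absurd h hq⟩
  choose r hr hr1 using hr
  let β : F →ₗ[A] R := b.constr A fun j => r (e₁.symm j)
  refine ⟨β, ?_, ?_⟩
  · rw [Module.Basis.constr_basis, he₁]
    exact hr1 _ rfl
  · rw [← LinearMap.range_eq_top, eq_top_iff]
    refine hs.trans (Submodule.span_le.2 ?_)
    rintro _ ⟨q, rfl⟩
    refine ⟨1 ⊗ₜ b (e₁ q), ?_⟩
    change v (β (b (e₁ q))) = _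
    rw [Module.Basis.constr_basis, e₁.symm_apply_apply, hr]

/-- A `β` found over the residue field of `p` puts `p` in the open set attached to `β`, and any
basic open neighbourhood inside that set serves. -/
theorem isOpenCovering_hilbSection (b : Module.Basis (Fin n) A F) (i : Fin n) :
    IsOpenCovering (fun β : {β : F →ₗ[A] R // β (b i) = 1} => hilbSection n β.1) := by
  refine ⟨fun β => isOpenSubfunctor_hilbSection β.1, fun B x p => ?_⟩
  let K := p.asIdeal.ResidueField
  let φ : B ⟶ CommAlgCat.of A K := CommAlgCat.ofHom (IsScalarTower.toAlgHom A B K)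
  obtain ⟨β, hβ, hs⟩ := exists_surjective_sectionMap_of_field b i
    ((hilb A R n).map φ x : HilbPoint (A := A) R n K)
  obtain ⟨U, hU⟩ := isOpenSubfunctor_hilbSection (n := n) β B x
  have hp : p ∈ U := by
    refine (hU _ φ).1 hs ⟨⊥, ?_⟩
    ext y
    simp only [φ, PrimeSpectrum.comap_asIdeal, Ideal.mem_comap]
    exact Ideal.algebraMap_residueField_eq_zero
  obtain ⟨_, ⟨f, rfl⟩, hpf, hfU⟩ :=
    PrimeSpectrum.isTopologicalBasis_basic_opens.exists_subset_of_mem_open hp U.isOpen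
  refine ⟨f, hpf, ⟨β, hβ⟩, (hU _ (awayHom B f)).2 ?_⟩
  refine subset_trans (subset_of_eq ?_) hfU
  exact PrimeSpectrum.localization_away_comap_range (Localization.Away f) f

end Covering

/-! ### Gluing schemes along overlaps that form an equivalence relation. -/

section Glue

open AlgebraicGeometry CategoryTheory.Limits

variable {J : Type u} {U : J → Scheme.{u}} {V : J → J → Scheme.{u}} (f : ∀ i j, V i j ⟶ U i)
  (g : ∀ i j, V i j ⟶ U j)

/-- Two morphisms `p : T → U i` and `q : T → U j` are identified by the overlap `V i j`. -/
def OverlapRel {T : Scheme.{u}} (i j : J) (p : T ⟶ U i) (q : T ⟶ U j) : Prop :=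
  ∃ r : T ⟶ V i j, r ≫ f i j = p ∧ r ≫ g i j = q

theorem exists_glued_desc (D : Scheme.GlueData.{u}) {Y : Scheme.{u}} (h : ∀ i, D.U i ⟶ Y)
    (hh : ∀ i j, D.f i j ≫ h i = (D.t i j ≫ D.f j i) ≫ h j) :
    ∃ k : D.glued ⟶ Y, ∀ i, D.ι i ≫ k = h i :=
  ⟨Multicoequalizer.desc D.diagram Y h fun ij => hh ij.1 ij.2,
    fun _ => Multicoequalizer.π_desc _ _ _ _ _⟩

/-- Schemes `U i` can be glued along overlaps `U i ← V i j → U j` whose functors of points form an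
equivalence relation. -/
theorem exists_glued [∀ i j, IsOpenImmersion (f i j)] (hdiag : ∀ i, f i i = g i i)
    (hrefl : ∀ {T : Scheme.{u}} (i) (p : T ⟶ U i), OverlapRel f g i i p p)
    (hsymm : ∀ {T : Scheme.{u}} (i j) (p : T ⟶ U i) (q : T ⟶ U j),
      OverlapRel f g i j p q → OverlapRel f g j i q p)
    (htrans : ∀ {T : Scheme.{u}} (i j k) (p : T ⟶ U i) (q : T ⟶ U j) (r : T ⟶ U k),
      OverlapRel f g i j p q → OverlapRel f g j k q r → OverlapRel f g i k p r) :
    ∃ (X : Scheme.{u}) (ι : ∀ i, U i ⟶ X), (∀ i, IsOpenImmersion (ι i)) ∧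
      (∀ x : X, ∃ i y, ι i y = x) ∧
      (∀ {T : Scheme.{u}} (i j) (p : T ⟶ U i) (q : T ⟶ U j),
        p ≫ ι i = q ≫ ι j ↔ OverlapRel f g i j p q) ∧
      ∀ {Y : Scheme.{u}} (h : ∀ i, U i ⟶ Y), (∀ i j, f i j ≫ h i = g i j ≫ h j) →
        ∃ k : X ⟶ Y, ∀ i, ι i ≫ k = h i := by
  -- Symmetry, applied to the tautological point of `V i j`, yields the transition map to `V j i`.
  choose t ht using fun i j => hsymm i j (f i j) (g i j) ⟨𝟙 _, by simp, by simp⟩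
  have htf : ∀ i j, t i j ≫ f j i = g i j := fun i j => (ht i j).1
  have htg : ∀ i j, t i j ≫ g j i = f i j := fun i j => (ht i j).2
  -- Transitivity through `U i`, applied to the tautological point of the triple overlap, yields the
  -- map to `V j k` needed for the cocycle data.
  choose s hs using fun i j k =>
    htrans j i k (pullback.fst (f i j) (f i k) ≫ g i j) (pullback.fst (f i j) (f i k) ≫ f i j)
      (pullback.snd (f i j) (f i k) ≫ g i k)
      (hsymm _ _ _ _ ⟨pullback.fst (f i j) (f i k), rfl, rfl⟩)
      ⟨pullback.snd (f i j) (f i k), pullback.condition.symm, rfl⟩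
  have hsf : ∀ i j k, s i j k ≫ f j k = pullback.fst (f i j) (f i k) ≫ g i j :=
    fun i j k => (hs i j k).1
  have hsg : ∀ i j k, s i j k ≫ g j k = pullback.snd (f i j) (f i k) ≫ g i k :=
    fun i j k => (hs i j k).2
  let t' : ∀ i j k, pullback (f i j) (f i k) ⟶ pullback (f j k) (f j i) := fun i j k =>
    pullback.lift (s i j k) (pullback.fst _ _ ≫ t i j) (by rw [hsf, Category.assoc, htf])
  have ht'1 : ∀ i j k, t' i j k ≫ pullback.fst _ _ = s i j k := fun i j k =>
    pullback.lift_fst _ _ _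
  have ht'2 : ∀ i j k, t' i j k ≫ pullback.snd _ _ = pullback.fst _ _ ≫ t i j := fun i j k =>
    pullback.lift_snd _ _ _
  have e1 : ∀ i j k, t' i j k ≫ pullback.fst _ _ ≫ f j k = pullback.fst _ _ ≫ g i j :=
    fun i j k => by rw [← Category.assoc, ht'1, hsf]
  have e2 : ∀ i j k, t' i j k ≫ pullback.fst _ _ ≫ g j k = pullback.snd _ _ ≫ g i k :=
    fun i j k => by rw [← Category.assoc, ht'1, hsg]
  have e3 : ∀ i j k, t' i j k ≫ pullback.snd _ _ ≫ g j i = pullback.fst _ _ ≫ f i j :=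
    fun i j k => by rw [← Category.assoc, ht'2, Category.assoc, htg]
  -- The triple overlap embeds into `U i`, so the identity may be checked there. By `e1`, `e2` and
  -- `e3`, each `t'` cyclically permutes the three projections.
  have hcocycle : ∀ i j k, t' i j k ≫ t' j k i ≫ t' k i j = 𝟙 _ := by
    intro i j k
    have : Mono (pullback.fst (f i j) (f i k) ≫ f i j) := inferInstance
    rw [← cancel_mono (pullback.fst (f i j) (f i k) ≫ f i j)]
    simp only [Category.assoc, Category.id_comp]
    rw [e1, e2, e3]
  have hiso : ∀ i, IsIso (f i i) := by
    intro i
    obtain ⟨r, hr, -⟩ := hrefl i (𝟙 (U i))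
    refine ⟨r, ?_, hr⟩
    rw [← cancel_mono (f i i), Category.assoc, hr, Category.comp_id, Category.id_comp]
  let D : Scheme.GlueData.{u} :=
    { J := J
      U := U
      V := fun ij => V ij.1 ij.2
      f := f
      f_id := hiso
      t := t
      t_id := fun i => by
        rw [← cancel_mono (f i i), htf, Category.id_comp, hdiag]
      t' := t'
      t_fac := fun i j k => ht'2 i j k
      cocycle := hcocycle
      f_open := inferInstance }
  refine ⟨D.glued, D.ι, fun i => D.ι_isOpenImmersion i, D.ι_jointly_surjective, ?_, ?_⟩
  · intro T i j p q
    constructor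
    · intro h
      let c : PullbackCone (D.ι i) (D.ι j) := PullbackCone.mk p q h
      refine ⟨(D.vPullbackConeIsLimit i j).lift c, ?_, ?_⟩
      · exact (D.vPullbackConeIsLimit i j).fac c WalkingCospan.left
      · rw [← htf]
        exact (D.vPullbackConeIsLimit i j).fac c WalkingCospan.right
    · rintro ⟨r, rfl, rfl⟩
      rw [Category.assoc, Category.assoc, ← htf, Category.assoc]
      congr 1
      exact (D.glue_condition i j).symm
  · intro Y h hh
    refine exists_glued_desc D h fun i j => ?_
    change f i j ≫ h i = (t i j ≫ f j i) ≫ h j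
    rw [htf, hh]

end Glue

/-! ### Zariski sheaves with a common local covering. -/

section Sheaf

variable {A : Type u} [CommRing A]

/-- A functor on `A`-algebras is a sheaf for the Zariski topology. -/
structure IsZariskiSheaf (H : CommAlgCat.{u} A ⥤ Type u) : Prop where
  ext : ∀ (B : CommAlgCat.{u} A) (s : Finset B), Ideal.span (s : Set B) = ⊤ →
    ∀ x y : H.obj B, (∀ f ∈ s, H.map (awayHom B f) x = H.map (awayHom B f) y) → x = y
  glue : ∀ (B : CommAlgCat.{u} A) (s : Finset B), Ideal.span (s : Set B) = ⊤ →
    ∀ x : (f : s) → H.obj (CommAlgCat.of A (Localization.Away f.1)),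
      (∀ (f g : s) (C : CommAlgCat.{u} A) (χ : CommAlgCat.of A (Localization.Away f.1) ⟶ C)
        (χ' : CommAlgCat.of A (Localization.Away g.1) ⟶ C),
        awayHom B f.1 ≫ χ = awayHom B g.1 ≫ χ' → H.map χ (x f) = H.map χ' (x g)) →
      ∃ y : H.obj B, ∀ f : s, H.map (awayHom B f.1) y = x f

/-- The elements `h i ∈ H(K i)` cover the functor `H` locally for the Zariski topology. -/
def IsLocalCover {ι : Type*} (H : CommAlgCat.{u} A ⥤ Type u) (K : ι → CommAlgCat.{u} A)
    (h : ∀ i, H.obj (K i)) : Prop :=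
  ∀ (B : CommAlgCat.{u} A) (x : H.obj B) (p : PrimeSpectrum B), ∃ f : B, f ∉ p.asIdeal ∧
    ∃ (i : ι) (ψ : K i ⟶ CommAlgCat.of A (Localization.Away f)),
      H.map (awayHom B f) x = H.map ψ (h i)

theorem exists_finset_of_forall_prime {B : Type*} [CommRing B] {P : B → Prop}
    (h : ∀ p : PrimeSpectrum B, ∃ f : B, f ∉ p.asIdeal ∧ P f) :
    ∃ s : Finset B, Ideal.span (s : Set B) = ⊤ ∧ ∀ f ∈ s, P f := by
  have hspan : Ideal.span {f | P f} = ⊤ := by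
    by_contra hne
    obtain ⟨m, hm, hle⟩ := Ideal.exists_le_maximal _ hne
    obtain ⟨f, hf, hPf⟩ := h ⟨m, hm.isPrime⟩
    exact hf (hle (Ideal.subset_span hPf))
  obtain ⟨s, hs, hs'⟩ := (Ideal.span_eq_top_iff_finite _).1 hspan
  exact ⟨s, hs', fun f hf => hs hf⟩

theorem exists_awayAlgHom_comp {B C : Type*} [CommRing B] [CommRing C] [Algebra A B]
    [Algebra A C] (φ : B →ₐ[A] C) (f : B) :
    ∃ a : Localization.Away f →ₐ[A] Localization.Away (φ f), ∀ b,
      a (algebraMap B _ b) = algebraMap C _ (φ b) := by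
  let k : B →ₐ[A] Localization.Away (φ f) :=
    (IsScalarTower.toAlgHom A C (Localization.Away (φ f))).comp φ
  have hk : IsUnit (k f) := IsLocalization.Away.algebraMap_isUnit (φ f)
  exact ⟨IsLocalization.Away.liftAlgHom f hk, fun b => IsLocalization.Away.lift_eq f hk b⟩

theorem exists_awayHom_comp {B C : CommAlgCat.{u} A} (φ : B ⟶ C) (f : B) :
    ∃ a : CommAlgCat.of A (Localization.Away f) ⟶
        CommAlgCat.of A (Localization.Away (φ.hom f)),
      awayHom B f ≫ a = φ ≫ awayHom C (φ.hom f) := by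
  obtain ⟨a, ha⟩ := exists_awayAlgHom_comp φ.hom f
  exact ⟨CommAlgCat.ofHom a, CommAlgCat.hom_ext (AlgHom.ext ha)⟩

theorem map_map_apply {D : Type*} [Category* D] (H : D ⥤ Type u) {B C E : D} (φ : B ⟶ C)
    (χ : C ⟶ E) (x : H.obj B) : H.map χ (H.map φ x) = H.map (φ ≫ χ) x := by
  simp

variable {ι : Type*} {P H : CommAlgCat.{u} A ⥤ Type u} {K : ι → CommAlgCat.{u} A}
  {p : ∀ i, P.obj (K i)} {h : ∀ i, H.obj (K i)}

/-- The elements `x ∈ P(B)` and `y ∈ H(B)` correspond to each other with respect to the local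
coverings `p` and `h`. -/
def Corresponds (p : ∀ i, P.obj (K i)) (h : ∀ i, H.obj (K i)) {B : CommAlgCat.{u} A}
    (x : P.obj B) (y : H.obj B) : Prop :=
  ∀ (C : CommAlgCat.{u} A) (φ : B ⟶ C) (i : ι) (ψ : K i ⟶ C),
    P.map φ x = P.map ψ (p i) ↔ H.map φ y = H.map ψ (h i)

theorem Corresponds.map {B C : CommAlgCat.{u} A} {x : P.obj B} {y : H.obj B}
    (hxy : Corresponds p h x y) (φ : B ⟶ C) : Corresponds p h (P.map φ x) (H.map φ y) := by
  intro D χ i ψ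
  rw [map_map_apply, map_map_apply]
  exact hxy D _ i ψ

theorem Corresponds.symm {B : CommAlgCat.{u} A} {x : P.obj B} {y : H.obj B}
    (hxy : Corresponds p h x y) : Corresponds h p y x :=
  fun C φ i ψ => (hxy C φ i ψ).symm

/-- Locally `x` is pulled back from some `p i`. Both partners must then be the pullback of `h i`
there, and sections of a sheaf that agree locally are equal. -/
theorem Corresponds.right_unique (hH : IsZariskiSheaf H) (hp : IsLocalCover P K p)
    {B : CommAlgCat.{u} A} {x : P.obj B} {y y' : H.obj B} (hy : Corresponds p h x y)
    (hy' : Corresponds p h x y') : y = y' := by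
  obtain ⟨s, hs, hsf⟩ := exists_finset_of_forall_prime (hp B x)
  refine hH.ext B s hs y y' fun f hf => ?_
  obtain ⟨i, ψ, hψ⟩ := hsf f hf
  rw [(hy _ _ i ψ).1 hψ, (hy' _ _ i ψ).1 hψ]

/-- Write `x` locally as pullbacks of the `p i`, take the same pullbacks of the `h i`, and glue;
`hrel` turns agreement in `P` into agreement in `H`. -/
theorem exists_corresponds (hP : IsZariskiSheaf P) (hH : IsZariskiSheaf H)
    (hp : IsLocalCover P K p)
    (hrel : ∀ (i j : ι) (C : CommAlgCat.{u} A) (ψ : K i ⟶ C) (ψ' : K j ⟶ C),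
      P.map ψ (p i) = P.map ψ' (p j) ↔ H.map ψ (h i) = H.map ψ' (h j))
    {B : CommAlgCat.{u} A} (x : P.obj B) : ∃ y : H.obj B, Corresponds p h x y := by
  obtain ⟨s, hs, hsf⟩ := exists_finset_of_forall_prime (hp B x)
  choose i ψ hψ using fun f : s => hsf f.1 f.2
  obtain ⟨y, hy⟩ := hH.glue B s hs (fun f => H.map (ψ f) (h (i f))) fun f g C χ χ' hχ => by
    rw [map_map_apply, map_map_apply, ← hrel, ← map_map_apply, ← hψ, ← map_map_apply P (ψ g),
      ← hψ, map_map_apply, map_map_apply, hχ]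
  refine ⟨y, fun C φ j ψ' => ?_⟩
  classical
  have hs' : Ideal.span ((s.image φ.hom : Finset C) : Set C) = ⊤ := by
    rw [Finset.coe_image]
    have := congrArg (Ideal.map (φ.hom : B →+* C)) hs
    rw [Ideal.map_span, Ideal.map_top] at this
    exact this
  -- Over each localization of `C`, the elements `x` and `y` are the same pullback of some `p i` and
  -- `h i`, so `hrel` compares the two equalities there.
  have key : ∀ f (hf : f ∈ s),
      P.map (awayHom C (φ.hom f)) (P.map φ x) = P.map (awayHom C (φ.hom f)) (P.map ψ' (p j)) ↔
      H.map (awayHom C (φ.hom f)) (H.map φ y) = H.map (awayHom C (φ.hom f)) (H.map ψ' (h j)) := by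
    intro f hf
    obtain ⟨a, ha⟩ := exists_awayHom_comp φ f
    have h1 := hψ ⟨f, hf⟩
    have h2 := hy ⟨f, hf⟩
    rw [map_map_apply P φ, map_map_apply P ψ', map_map_apply H φ, map_map_apply H ψ', ← ha,
      ← map_map_apply P, ← map_map_apply H (awayHom B f), h1, h2, map_map_apply, map_map_apply]
    exact hrel _ _ _ _ _
  constructor
  · intro hx
    refine hH.ext C _ hs' _ _ fun c hc => ?_
    obtain ⟨f, hf, rfl⟩ := Finset.mem_image.1 hc
    rw [← key f hf, hx]
  · intro hy'
    refine hP.ext C _ hs' _ _ fun c hc => ?_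
    obtain ⟨f, hf, rfl⟩ := Finset.mem_image.1 hc
    rw [key f hf, hy']

/-- Two Zariski sheaves with the same local covering and the same overlaps are isomorphic. -/
theorem nonempty_iso_of_isLocalCover (hP : IsZariskiSheaf P) (hH : IsZariskiSheaf H)
    (hp : IsLocalCover P K p) (hh : IsLocalCover H K h)
    (hrel : ∀ (i j : ι) (C : CommAlgCat.{u} A) (ψ : K i ⟶ C) (ψ' : K j ⟶ C),
      P.map ψ (p i) = P.map ψ' (p j) ↔ H.map ψ (h i) = H.map ψ' (h j)) :
    Nonempty (P ≅ H) := by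
  choose y hy using fun (B : CommAlgCat.{u} A) (x : P.obj B) =>
    exists_corresponds hP hH hp hrel x
  let Ψ : P ⟶ H :=
    { app := fun B => ↾(y B)
      naturality := fun B C φ => by
        ext x
        exact Corresponds.right_unique hH hp (hy C (P.map φ x)) ((hy B x).map φ) }
  have : ∀ B, IsIso (Ψ.app B) := fun B => (isIso_iff_bijective _).2 ⟨fun x x' hxx' => by
      have h1 := hy B x
      have h2 : y B x = y B x' := hxx'
      rw [h2] at h1
      exact Corresponds.right_unique hP hh h1.symm (hy B x').symm, fun z => by
      obtain ⟨x, hx⟩ := exists_corresponds hH hP hh (fun i j C ψ ψ' => (hrel i j C ψ ψ').symm) z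
      exact ⟨x, Corresponds.right_unique hH hp (hy B x) hx.symm⟩⟩
  have : IsIso Ψ := NatIso.isIso_of_isIso_app Ψ
  exact ⟨asIso Ψ⟩

end Sheaf

/-! ### The functor of points of a scheme over `Spec A`. -/

section Representability

open AlgebraicGeometry CategoryTheory.Limits Opposite

variable {A : Type u} [CommRing A]

/-- The morphism of spectra attached to a homomorphism of `A`-algebras. -/
def specHom {B C : CommAlgCat.{u} A} (φ : B ⟶ C) :
    Spec (CommRingCat.of C) ⟶ Spec (CommRingCat.of B) :=
  Spec.map (CommRingCat.ofHom (φ.hom : B →+* C))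

/-- The structure morphism of the spectrum of an `A`-algebra. -/
def specStr (B : CommAlgCat.{u} A) : Spec (CommRingCat.of B) ⟶ Spec (CommRingCat.of A) :=
  Spec.map (CommRingCat.ofHom (algebraMap A B))

theorem specHom_comp_specStr {B C : CommAlgCat.{u} A} (φ : B ⟶ C) :
    specHom φ ≫ specStr B = specStr C := by
  rw [specHom, specStr, specStr, ← Spec.map_comp, ← CommRingCat.ofHom_comp]
  congr 2
  exact RingHom.ext fun a => φ.hom.commutes a

/-- Points of a scheme over `Spec A`, as morphisms over `Spec A`. -/
def pointMk {X : Over (Spec (CommRingCat.of A))} {B : CommAlgCat.{u} A}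
    (s : Spec (CommRingCat.of B) ⟶ X.left) (hs : s ≫ X.hom = specStr B) :
    (pointsFunctor X).obj B :=
  (Over.homMk s hs : (algSpec (CommRingCat.of A)).obj (op B) ⟶ X)

/-- The underlying morphism of schemes of a point. -/
def pointLeft {X : Over (Spec (CommRingCat.of A))} {B : CommAlgCat.{u} A}
    (s : (pointsFunctor X).obj B) : Spec (CommRingCat.of B) ⟶ X.left :=
  Over.Hom.left (show (algSpec (CommRingCat.of A)).obj (op B) ⟶ X from s)

variable {X : Over (Spec (CommRingCat.of A))} {B C : CommAlgCat.{u} A}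

theorem pointLeft_comp_hom (s : (pointsFunctor X).obj B) : pointLeft s ≫ X.hom = specStr B :=
  Over.w (show (algSpec (CommRingCat.of A)).obj (op B) ⟶ X from s)

theorem pointLeft_injective {s t : (pointsFunctor X).obj B} (h : pointLeft s = pointLeft t) :
    s = t :=
  Over.OverMorphism.ext (U := (algSpec (CommRingCat.of A)).obj (op B)) h

theorem pointLeft_map (φ : B ⟶ C) (s : (pointsFunctor X).obj B) :
    pointLeft ((pointsFunctor X).map φ s) = specHom φ ≫ pointLeft s := rfl

/-- The affine open covering of `Spec B` by the basic open sets of a finite set that generates the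
unit ideal. -/
def awayCover (B : CommAlgCat.{u} A) (s : Finset B) (hs : Ideal.span (s : Set B) = ⊤) :
    (Spec (CommRingCat.of B)).OpenCover :=
  (Scheme.affineOpenCoverOfSpanRangeEqTop (R := CommRingCat.of B) (fun f : s => f.1)
    (by simpa using hs)).openCover

theorem isZariskiSheaf_pointsFunctor (X : Over (Spec (CommRingCat.of A))) :
    IsZariskiSheaf (pointsFunctor X) where
  ext B s hs x y h := by
    refine pointLeft_injective ((awayCover B s hs).hom_ext _ _ fun f => ?_)
    exact congrArg pointLeft (h f.1 f.2)
  glue B s hs x hx := by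
    let 𝒰 := awayCover B s hs
    let m : ∀ f : s, Spec (CommRingCat.of (Localization.Away f.1)) ⟶ Spec (CommRingCat.of B) :=
      fun f => Spec.map (CommRingCat.ofHom (algebraMap B (Localization.Away f.1)))
    have hcompat : ∀ f g : s, pullback.fst (m f) (m g) ≫ pointLeft (x f) =
        pullback.snd (m f) (m g) ≫ pointLeft (x g) := by
      intro f g
      -- The intersection of `D(f)` and `D(g)` is the spectrum of this tensor product, so
      -- compatibility over it is agreement on the overlap.
      let D := CommAlgCat.of A (Localization.Away f.1 ⊗[B] Localization.Away g.1)
      let χ : CommAlgCat.of A (Localization.Away f.1) ⟶ D :=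
        CommAlgCat.ofHom (Algebra.TensorProduct.includeLeft)
      let χ' : CommAlgCat.of A (Localization.Away g.1) ⟶ D :=
        CommAlgCat.ofHom (Algebra.TensorProduct.includeRight.restrictScalars A)
      have h1 := congrArg pointLeft (hx f g D χ χ' (by
        refine CommAlgCat.hom_ext (AlgHom.ext fun b => ?_)
        change (algebraMap B _ b) ⊗ₜ[B] 1 = 1 ⊗ₜ[B] (algebraMap B _ b)
        rw [Algebra.algebraMap_eq_smul_one, Algebra.algebraMap_eq_smul_one, smul_tmul]))
      rw [pointLeft_map, pointLeft_map] at h1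
      rw [← cancel_epi (pullbackSpecIso B (Localization.Away f.1) (Localization.Away g.1)).inv]
      have e1 : (pullbackSpecIso B (Localization.Away f.1) (Localization.Away g.1)).inv ≫
        pullback.fst (m f) (m g) = specHom χ := pullbackSpecIso_inv_fst ..
      have e2 : (pullbackSpecIso B (Localization.Away f.1) (Localization.Away g.1)).inv ≫
        pullback.snd (m f) (m g) = specHom χ' := pullbackSpecIso_inv_snd ..
      rw [reassoc_of% e1, reassoc_of% e2]
      exact h1
    let y := 𝒰.glueMorphisms (fun f : s => pointLeft (x f)) hcompat
    have hy : ∀ f : s, specHom (awayHom B f.1) ≫ y = pointLeft (x f) := fun f =>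
      𝒰.ι_glueMorphisms _ hcompat f
    refine ⟨pointMk y (𝒰.hom_ext _ _ fun f => ?_), fun f => pointLeft_injective (hy f)⟩
    change specHom (awayHom B f.1) ≫ y ≫ X.hom = specHom (awayHom B f.1) ≫ specStr B
    rw [reassoc_of% hy f, pointLeft_comp_hom, specHom_comp_specStr]

theorem exists_specHom_eq (s : Spec (CommRingCat.of C) ⟶ Spec (CommRingCat.of B))
    (hs : s ≫ specStr B = specStr C) : ∃ φ : B ⟶ C, specHom φ = s := by
  obtain ⟨φ, rfl⟩ := Spec.map_surjective s
  rw [specStr, specStr, ← Spec.map_comp, Spec.map_inj] at hs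
  let φ' : B →ₐ[A] C :=
    { φ.hom with commutes' := fun a => RingHom.congr_fun (congrArg CommRingCat.Hom.hom hs) a }
  exact ⟨CommAlgCat.ofHom φ', rfl⟩

/-- Open immersions that are jointly surjective cover the functor of points locally. -/
theorem isLocalCover_pointsFunctor {J : Type*} (K : J → CommAlgCat.{u} A)
    (p : ∀ i, (pointsFunctor X).obj (K i)) [∀ i, IsOpenImmersion (pointLeft (p i))]
    (hp : ∀ x : X.left, ∃ i y, pointLeft (p i) y = x) : IsLocalCover (pointsFunctor X) K p := by
  intro B x q
  obtain ⟨i, y, hy⟩ := hp (pointLeft x q)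
  let W : (Spec (CommRingCat.of B)).Opens := pointLeft x ⁻¹ᵁ (pointLeft (p i)).opensRange
  have hqW : q ∈ (W.1 : Set (PrimeSpectrum B)) := ⟨y, hy⟩
  obtain ⟨_, ⟨f, rfl⟩, hqf, hfW⟩ :=
    PrimeSpectrum.isTopologicalBasis_basic_opens.exists_subset_of_mem_open hqW W.isOpen
  refine ⟨f, hqf, i, ?_⟩
  have hrange : Set.range (specHom (awayHom B f) ≫ pointLeft x) ⊆
      Set.range (pointLeft (p i)) := by
    rintro _ ⟨z, rfl⟩
    have hz : specHom (awayHom B f) z ∈ (PrimeSpectrum.basicOpen f : Set (PrimeSpectrum B)) := by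
      rw [← PrimeSpectrum.localization_away_comap_range (Localization.Away f) f]
      exact ⟨z, rfl⟩
    rw [Scheme.Hom.comp_apply]
    exact hfW hz
  let l := IsOpenImmersion.lift (pointLeft (p i)) (specHom (awayHom B f) ≫ pointLeft x) hrange
  have hl : l ≫ pointLeft (p i) = specHom (awayHom B f) ≫ pointLeft x :=
    IsOpenImmersion.lift_fac _ _ _
  obtain ⟨ψ, hψ⟩ := exists_specHom_eq (B := K i) (C := CommAlgCat.of A (Localization.Away f)) l
    (by rw [← pointLeft_comp_hom (p i), reassoc_of% hl, pointLeft_comp_hom, specHom_comp_specStr])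
  refine ⟨ψ, pointLeft_injective ?_⟩
  rw [pointLeft_map, pointLeft_map, hψ, hl]

end Representability

/-! ### Representability from affine charts with affine open overlaps. -/

section Overlap

open AlgebraicGeometry CategoryTheory.Limits Opposite

variable {A : Type u} [CommRing A] {H : CommAlgCat.{u} A ⥤ Type u} {J : Type u}
  {K : J → CommAlgCat.{u} A} {h : ∀ i, H.obj (K i)} {L : J → J → CommAlgCat.{u} A}
  {a : ∀ i j, K i ⟶ L i j} {b : ∀ i j, K j ⟶ L i j}

/-- Ring homomorphisms from `K i` and `K j` that factor through the overlap `L i j`. -/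
def RingOverlap (a : ∀ i j, K i ⟶ L i j) (b : ∀ i j, K j ⟶ L i j) (i j : J)
    {G : CommRingCat.{u}} (φ : CommRingCat.of (K i) ⟶ G) (φ' : CommRingCat.of (K j) ⟶ G) : Prop :=
  ∃ χ : CommRingCat.of (L i j) ⟶ G, CommRingCat.ofHom ((a i j).hom : K i →+* L i j) ≫ χ = φ ∧
    CommRingCat.ofHom ((b i j).hom : K j →+* L i j) ≫ χ = φ'

/-- The algebras `L i j` represent the overlaps of the elements `h i ∈ H(K i)`. -/
structure IsOverlap (h : ∀ i, H.obj (K i)) (a : ∀ i j, K i ⟶ L i j) (b : ∀ i j, K j ⟶ L i j) :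
    Prop where
  comm : ∀ i j, H.map (a i j) (h i) = H.map (b i j) (h j)
  lift : ∀ (i j : J) (C : CommAlgCat.{u} A) (ψ : K i ⟶ C) (ψ' : K j ⟶ C),
    H.map ψ (h i) = H.map ψ' (h j) → ∃ χ : L i j ⟶ C, a i j ≫ χ = ψ ∧ b i j ≫ χ = ψ'

/-- Gluing takes place among all schemes, not only those over `Spec A`, so overlaps are phrased with
plain ring homomorphisms. A ring homomorphism through which the `A`-linear `ψ` factors over `L i j`
is itself `A`-linear. -/
theorem IsOverlap.ringOverlap_iff (hab : IsOverlap h a b) (i j : J) {C : CommAlgCat.{u} A} (ψ : K i ⟶ C) (ψ' : K j ⟶ C) :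
    RingOverlap a b i j (CommRingCat.ofHom (ψ.hom : K i →+* C))
      (CommRingCat.ofHom (ψ'.hom : K j →+* C)) ↔ H.map ψ (h i) = H.map ψ' (h j) := by
  constructor
  · rintro ⟨χ, h1, h2⟩
    have h1' : ∀ x, χ.hom ((a i j).hom x) = ψ.hom x := fun x =>
      RingHom.congr_fun (congrArg CommRingCat.Hom.hom h1) x
    have h2' : ∀ x, χ.hom ((b i j).hom x) = ψ'.hom x := fun x =>
      RingHom.congr_fun (congrArg CommRingCat.Hom.hom h2) x
    let χ' : L i j →ₐ[A] C :=
      { χ.hom with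
        commutes' := fun r => by
          change χ.hom (algebraMap A (L i j) r) = _
          rw [← (a i j).hom.commutes, h1', ψ.hom.commutes] }
    have e1 : a i j ≫ CommAlgCat.ofHom χ' = ψ := CommAlgCat.hom_ext (AlgHom.ext h1')
    have e2 : b i j ≫ CommAlgCat.ofHom χ' = ψ' := CommAlgCat.hom_ext (AlgHom.ext h2')
    rw [← e1, ← e2, ← map_map_apply, hab.comm, map_map_apply]
  · intro hh
    obtain ⟨χ, rfl, rfl⟩ := hab.lift i j C ψ ψ' hh
    exact ⟨CommRingCat.ofHom (χ.hom : L i j →+* C), rfl, rfl⟩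

theorem RingOverlap.algebraMap_eq {i j : J} {G : CommRingCat.{u}}
    {φ : CommRingCat.of (K i) ⟶ G} {φ' : CommRingCat.of (K j) ⟶ G}
    (hφ : RingOverlap a b i j φ φ') (r : A) :
    φ'.hom (algebraMap A (K j) r) = φ.hom (algebraMap A (K i) r) := by
  obtain ⟨χ, rfl, rfl⟩ := hφ
  change χ.hom ((b i j).hom _) = χ.hom ((a i j).hom _)
  rw [AlgHom.commutes, AlgHom.commutes]

/-- A ring homomorphism `K → G` that is compatible with a given `A`-algebra structure. -/
def homOfCommutes {K : CommAlgCat.{u} A} {G : CommRingCat.{u}} [Algebra A G]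
    (φ : CommRingCat.of K ⟶ G) (hφ : ∀ r, φ.hom (algebraMap A K r) = algebraMap A G r) :
    K ⟶ CommAlgCat.of A G :=
  CommAlgCat.ofHom { φ.hom with commutes' := hφ }

/-- The ring `G` receives its `A`-algebra structure through `φ`; `RingOverlap.algebraMap_eq` makes
every homomorphism related to `φ` linear too. Reflexivity, symmetry and transitivity then become
those of equality in `H(G)`. -/
theorem RingOverlap.refl (hab : IsOverlap h a b) (i : J) {G : CommRingCat.{u}} (φ : CommRingCat.of (K i) ⟶ G) :
    RingOverlap a b i i φ φ := by
  let _ : Algebra A G := (φ.hom.comp (algebraMap A (K i))).toAlgebra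
  exact (hab.ringOverlap_iff i i (homOfCommutes φ fun _ => rfl)
    (homOfCommutes φ fun _ => rfl)).2 rfl

theorem RingOverlap.symm (hab : IsOverlap h a b) {i j : J} {G : CommRingCat.{u}} {φ : CommRingCat.of (K i) ⟶ G}
    {φ' : CommRingCat.of (K j) ⟶ G} (hφ : RingOverlap a b i j φ φ') :
    RingOverlap a b j i φ' φ := by
  let _ : Algebra A G := (φ.hom.comp (algebraMap A (K i))).toAlgebra
  let ψ := homOfCommutes φ fun _ => rfl
  let ψ' := homOfCommutes φ' fun r => hφ.algebraMap_eq r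
  have h1 := (hab.ringOverlap_iff i j ψ ψ').1 hφ
  exact (hab.ringOverlap_iff j i ψ' ψ).2 h1.symm

theorem RingOverlap.trans (hab : IsOverlap h a b) {i j k : J} {G : CommRingCat.{u}} {φ : CommRingCat.of (K i) ⟶ G}
    {φ' : CommRingCat.of (K j) ⟶ G} {φ'' : CommRingCat.of (K k) ⟶ G}
    (hφ : RingOverlap a b i j φ φ') (hφ' : RingOverlap a b j k φ' φ'') :
    RingOverlap a b i k φ φ'' := by
  let _ : Algebra A G := (φ.hom.comp (algebraMap A (K i))).toAlgebra
  let ψ := homOfCommutes φ fun _ => rfl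
  let ψ' := homOfCommutes φ' fun r => hφ.algebraMap_eq r
  let ψ'' := homOfCommutes φ'' fun r => (hφ'.algebraMap_eq r).trans (hφ.algebraMap_eq r)
  have h1 := (hab.ringOverlap_iff i j ψ ψ').1 hφ
  have h2 := (hab.ringOverlap_iff j k ψ' ψ'').1 hφ'
  exact (hab.ringOverlap_iff i k ψ ψ'').2 (h1.trans h2)

/-- The ring homomorphism attached to a morphism to an affine scheme. -/
def toΓ {T : Scheme.{u}} {S : CommRingCat.{u}} (p : T ⟶ Spec S) : S ⟶ Γ(T, ⊤) :=
  ((ΓSpec.adjunction.homEquiv T (op S)).symm p).unop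

theorem toΓ_comp {T : Scheme.{u}} {S S' : CommRingCat.{u}} (p : T ⟶ Spec S) (φ : S' ⟶ S) :
    toΓ (p ≫ Spec.map φ) = φ ≫ toΓ p :=
  congrArg Quiver.Hom.unop
    (Adjunction.homEquiv_naturality_right_symm ΓSpec.adjunction p φ.op)

theorem toΓ_injective {T : Scheme.{u}} {S : CommRingCat.{u}} {p q : T ⟶ Spec S}
    (hpq : toΓ p = toΓ q) : p = q :=
  (ΓSpec.adjunction.homEquiv T (op S)).symm.injective (Quiver.Hom.unop_inj hpq)

theorem toΓ_surjective {T : Scheme.{u}} {S : CommRingCat.{u}} (φ : S ⟶ Γ(T, ⊤)) :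
    ∃ p : T ⟶ Spec S, toΓ p = φ :=
  ⟨ΓSpec.adjunction.homEquiv T (op S) φ.op,
    congrArg Quiver.Hom.unop ((ΓSpec.adjunction.homEquiv T (op S)).symm_apply_apply φ.op)⟩

/-- Morphisms from any `T` to an affine scheme are ring homomorphisms to the global sections of `T`,
so the relation on arbitrary schemes reduces to rings. -/
theorem overlapRel_iff {T : Scheme.{u}} (i j : J) (p : T ⟶ Spec (CommRingCat.of (K i)))
    (q : T ⟶ Spec (CommRingCat.of (K j))) :
    OverlapRel (fun i j => specHom (a i j)) (fun i j => specHom (b i j)) i j p q ↔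
      RingOverlap a b i j (toΓ p) (toΓ q) := by
  constructor
  · rintro ⟨r, rfl, rfl⟩
    exact ⟨toΓ r, (toΓ_comp _ _).symm, (toΓ_comp _ _).symm⟩
  · rintro ⟨χ, h1, h2⟩
    obtain ⟨r, rfl⟩ := toΓ_surjective χ
    exact ⟨r, toΓ_injective ((toΓ_comp _ _).trans h1), toΓ_injective ((toΓ_comp _ _).trans h2)⟩

theorem overlapRel_specHom_iff (i j : J) {C : CommAlgCat.{u} A} (ψ : K i ⟶ C) (ψ' : K j ⟶ C) :
    OverlapRel (fun i j => specHom (a i j)) (fun i j => specHom (b i j)) i j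
      (specHom ψ) (specHom ψ') ↔
      RingOverlap a b i j (CommRingCat.ofHom (ψ.hom : K i →+* C))
        (CommRingCat.ofHom (ψ'.hom : K j →+* C)) := by
  constructor
  · rintro ⟨r, h1, h2⟩
    obtain ⟨χ, rfl⟩ := Spec.map_surjective r
    exact ⟨χ, Spec.map_injective ((Spec.map_comp _ _).trans h1),
      Spec.map_injective ((Spec.map_comp _ _).trans h2)⟩
  · rintro ⟨χ, h1, h2⟩
    exact ⟨Spec.map χ, (Spec.map_comp _ _).symm.trans (congrArg Spec.map h1),
      (Spec.map_comp _ _).symm.trans (congrArg Spec.map h2)⟩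

/-- A Zariski sheaf that is covered by affine schemes with affine open overlaps is represented by
a scheme. -/
theorem isRepresentableByScheme_of_isOverlap (hH : IsZariskiSheaf H) (hcov : IsLocalCover H K h)
    (hmono : ∀ (i : J) (C : CommAlgCat.{u} A) (ψ ψ' : K i ⟶ C),
      H.map ψ (h i) = H.map ψ' (h i) → ψ = ψ')
    (hab : IsOverlap h a b) (hopen : ∀ i j, IsOpenImmersion (specHom (a i j))) :
    IsRepresentableByScheme H := by
  obtain ⟨X, ι, hι, hsurj, hrel, hdesc⟩ := exists_glued
    (fun i j => specHom (a i j)) (fun i j => specHom (b i j))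
    (fun i => congrArg specHom (hmono i _ _ _ (hab.comm i i)))
    (fun i p => (overlapRel_iff i i p p).2 (RingOverlap.refl hab i _))
    (fun i j p q hpq => (overlapRel_iff j i q p).2
      (RingOverlap.symm hab ((overlapRel_iff i j p q).1 hpq)))
    (fun i j k p q r hpq hqr => (overlapRel_iff i k p r).2
      (RingOverlap.trans hab ((overlapRel_iff i j p q).1 hpq) ((overlapRel_iff j k q r).1 hqr)))
  obtain ⟨k, hk⟩ := hdesc (fun i => specStr (K i)) fun i j => by
    rw [specHom_comp_specStr, specHom_comp_specStr]
  let Y : Over (Spec (CommRingCat.of A)) := Over.mk k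
  let p : ∀ i, (pointsFunctor Y).obj (K i) := fun i => pointMk (ι i) (hk i)
  have hp : ∀ i, IsOpenImmersion (pointLeft (p i)) := hι
  refine ⟨Y, nonempty_iso_of_isLocalCover (isZariskiSheaf_pointsFunctor Y) hH
    (isLocalCover_pointsFunctor K p hsurj) hcov fun i j C ψ ψ' => ?_⟩
  rw [← hab.ringOverlap_iff, ← overlapRel_specHom_iff, ← hrel]
  exact ⟨fun hh => congrArg pointLeft hh, fun hh => pointLeft_injective hh⟩

end Overlap

/-! ### The Hilbert functor is a Zariski sheaf. -/

section HilbSheaf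

variable {A : Type u} [CommRing A] {R : Type u} [CommRing R] [Algebra A R] {n : ℕ}

/-- Inclusions of ideals of `B ⊗ R` are local on `Spec B`. -/
theorem ideal_le_of_away {B : Type*} [CommRing B] [Algebra A B] (s : Set B)
    (hs : Ideal.span s = ⊤) (I J : Ideal (B ⊗[A] R))
    (h : ∀ f ∈ s, I.map (baseMap R (IsScalarTower.toAlgHom A B (Localization.Away f))) ≤
      J.map (baseMap R (IsScalarTower.toAlgHom A B (Localization.Away f)))) : I ≤ J := by
  intro z hz
  refine Submodule.mem_of_span_eq_top_of_smul_pow_mem (J.restrictScalars B) s hs z fun f => ?_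
  exact (mem_map_baseMap_away_iff (C := Localization.Away f.1) f.1 J z).1
    (h f.1 f.2 (Ideal.mem_map_of_mem _ hz))

theorem baseMap_comp_apply {B C D : Type*} [CommRing B] [CommRing C] [CommRing D] [Algebra A B]
    [Algebra A C] [Algebra A D] (φ : B →ₐ[A] C) (χ : C →ₐ[A] D) (z : B ⊗[A] R) :
    baseMap R χ (baseMap R φ z) = baseMap R (χ.comp φ) z := by
  rw [baseMap, baseMap, ← AlgHom.comp_apply, ← Algebra.TensorProduct.map_comp, AlgHom.comp_id]

theorem exists_algHom_comp_away {B D : Type*} [CommRing B] [CommRing D] [Algebra A B]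
    [Algebra A D] (k : B →ₐ[A] D) (f : B) (hk : IsUnit (k f)) :
    ∃ χ : Localization.Away f →ₐ[A] D, χ.comp (IsScalarTower.toAlgHom A B _) = k :=
  ⟨IsLocalization.Away.liftAlgHom f hk,
    AlgHom.ext fun b => IsLocalization.Away.lift_eq f hk b⟩

/-- An element whose image lies in an ideal wherever `f` is invertible lies in the ideal up to a
power of `f`. -/
theorem exists_pow_smul_mem_of_away {B : Type*} {D : Type u} [CommRing B] [CommRing D]
    [Algebra A B] [Algebra A D] (ρ : B →ₐ[A] D) (f : B) (w : D ⊗[A] R) (I : Ideal (D ⊗[A] R))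
    (h : ∀ (C : Type u) [CommRing C] [Algebra A C] (χ : D →ₐ[A] C), IsUnit (χ.comp ρ f) →
      baseMap R χ w ∈ I.map (baseMap R χ)) :
    ∃ m : ℕ, ρ f ^ m • w ∈ I :=
  (mem_map_baseMap_away_iff (C := Localization.Away (ρ f)) (ρ f) I w).1
    (h _ (IsScalarTower.toAlgHom A D (Localization.Away (ρ f)))
      (IsLocalization.Away.algebraMap_isUnit (ρ f)))

/-- Compatible ideals on a finite basic open covering of `Spec B` glue. -/
theorem exists_ideal_glue {B : Type u} [CommRing B] [Algebra A B] (s : Finset B)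
    (I : (f : s) → Ideal (Localization.Away f.1 ⊗[A] R))
    (hI : ∀ (f g : s) (C : Type u) [CommRing C] [Algebra A C] (χ : Localization.Away f.1 →ₐ[A] C)
      (χ' : Localization.Away g.1 →ₐ[A] C),
      χ.comp (IsScalarTower.toAlgHom A B _) = χ'.comp (IsScalarTower.toAlgHom A B _) →
      (I f).map (baseMap R χ) = (I g).map (baseMap R χ')) :
    ∃ J : Ideal (B ⊗[A] R), ∀ f : s,
      J.map (baseMap R (IsScalarTower.toAlgHom A B (Localization.Away f.1))) = I f := by
  let ρ : ∀ f : s, B →ₐ[A] Localization.Away f.1 := fun f => IsScalarTower.toAlgHom A B _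
  let J : Ideal (B ⊗[A] R) := ⨅ f : s, (I f).comap (baseMap R (ρ f))
  have hJ : ∀ z, z ∈ J ↔ ∀ f, baseMap R (ρ f) z ∈ I f := fun z => by
    simp only [J, Submodule.mem_iInf, Ideal.mem_comap]
  refine ⟨J, fun f => le_antisymm (Ideal.map_le_iff_le_comap.2 (iInf_le _ f)) fun y hy => ?_⟩
  have hunit : ∀ k : ℕ, ∀ w : Localization.Away f.1 ⊗[A] R,
      algebraMap B (Localization.Away f.1) f.1 ^ k • w ∈ J.map (baseMap R (ρ f)) →
      w ∈ J.map (baseMap R (ρ f)) := by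
    intro k w hw
    obtain ⟨c, hc⟩ := (IsLocalization.Away.algebraMap_pow_isUnit
      (S := Localization.Away f.1) f.1 k).exists_left_inv
    have := Submodule.smul_of_tower_mem (J.map (baseMap R (ρ f))) c hw
    rwa [smul_smul, hc, one_smul] at this
  obtain ⟨k, z, hz⟩ := exists_baseMap_eq_pow_smul (C := Localization.Away f.1) f.1 y
  have hzI : baseMap R (ρ f) z ∈ I f := by
    change baseMap R (IsScalarTower.toAlgHom A B (Localization.Away f.1)) z ∈ I f
    rw [hz]
    exact Submodule.smul_of_tower_mem (I f) _ hy
  -- Over any algebra under `B_g` in which `f` is invertible, compatibility carries the membership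
  -- of `z` in `I f` over to `I g`. It therefore holds in `B_g` up to a power of `f`.
  have hloc : ∀ g : s, ∃ m : ℕ, ρ g f.1 ^ m • baseMap R (ρ g) z ∈ I g := by
    intro g
    refine exists_pow_smul_mem_of_away (ρ g) f.1 (baseMap R (ρ g) z) (I g) fun C _ _ χ' hu => ?_
    obtain ⟨χ, hχ⟩ := exists_algHom_comp_away (χ'.comp (ρ g)) f.1 hu
    have h1 : baseMap R χ (baseMap R (ρ f) z) ∈ (I f).map (baseMap R χ) :=
      Ideal.mem_map_of_mem _ hzI
    have h2 : baseMap R χ (baseMap R (ρ f) z) = baseMap R χ' (baseMap R (ρ g) z) := by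
      rw [baseMap_comp_apply, baseMap_comp_apply]
      exact congrArg (fun k => baseMap R k z) hχ
    rw [hI f g C χ χ' hχ, h2] at h1
    exact h1
  choose m hm using hloc
  -- The sum of the finitely many exponents is at least each of them, so a single power of `f`
  -- serves every `g`.
  have hmem : f.1 ^ (∑ g, m g) • z ∈ J := by
    rw [hJ]
    intro g
    obtain ⟨l, hl⟩ := Nat.exists_eq_add_of_le'
      (Finset.single_le_sum (f := m) (fun _ _ => Nat.zero_le _) (Finset.mem_univ g))
    have h3 : baseMap R (ρ g) (f.1 ^ (∑ g, m g) • z) =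
        ρ g f.1 ^ l • ρ g f.1 ^ m g • baseMap R (ρ g) z := by
      rw [smul_smul, ← pow_add, ← hl, baseMap_smul, map_pow]
    rw [h3]
    exact Submodule.smul_of_tower_mem (I g) _ (hm g)
  refine hunit k y (hunit (∑ g, m g) _ ?_)
  have h4 := Ideal.mem_map_of_mem (baseMap R (ρ f)) hmem
  rw [baseMap_smul, map_pow] at h4
  rw [← hz]
  exact h4

/-- A point is an ideal with locally free quotient. Ideals are determined locally and glue, and
local freeness is itself a local condition. -/
theorem isZariskiSheaf_hilb : IsZariskiSheaf (hilb A R n) where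
  ext B s hs x y h := by
    have h' : ∀ f ∈ s, (x : HilbPoint (A := A) R n B).ideal.map
        (baseMap R (IsScalarTower.toAlgHom A B (Localization.Away f))) =
        (y : HilbPoint (A := A) R n B).ideal.map
        (baseMap R (IsScalarTower.toAlgHom A B (Localization.Away f))) := fun f hf =>
      congrArg HilbPoint.ideal (h f hf)
    exact HilbPoint.ext (le_antisymm
      (ideal_le_of_away s hs _ _ fun f hf => (h' f hf).le)
      (ideal_le_of_away s hs _ _ fun f hf => (h' f hf).ge))
  glue B s hs x hx := by
    let x' : ∀ f : s, HilbPoint (A := A) R n (Localization.Away f.1) := x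
    obtain ⟨J, hJ⟩ := exists_ideal_glue s (fun f => (x' f).ideal) fun f g C _ _ χ χ' hχ =>
      congrArg HilbPoint.ideal (hx f g (CommAlgCat.of A C) (CommAlgCat.ofHom χ)
        (CommAlgCat.ofHom χ') (CommAlgCat.hom_ext hχ))
    refine ⟨(⟨J, .of_away fun p => ?_⟩ : HilbPoint (A := A) R n B), fun f => HilbPoint.ext (hJ f)⟩
    have hp : ∃ f ∈ s, f ∉ p.asIdeal := by
      by_contra! hcon
      exact p.isPrime.ne_top (top_le_iff.1 (hs ▸ Ideal.span_le.2 hcon))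
    obtain ⟨f, hf, hfp⟩ := hp
    refine ⟨f, hfp, ?_⟩
    obtain ⟨e⟩ := nonempty_quotient_equiv (A := A) R (C := Localization.Away f) J
    have h := (x' ⟨f, hf⟩).isLocallyFree
    rw [← hJ ⟨f, hf⟩] at h
    exact h.congr e.symm.toLinearEquiv

end HilbSheaf

/-! ### Overlaps of the charts and representability of the Hilbert functor. -/

section HilbOverlap

variable {A : Type u} [CommRing A] {R F : Type u} [CommRing R] [Algebra A R] [AddCommGroup F]
  [Module A F] [Module.Free A F] [Module.Finite A F] {n : ℕ}

theorem surjective_iff_isUnit_det {C : Type*} [CommRing C] {P : Type*} [AddCommGroup P]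
    [Module C P] [Module.Free C P] [Module.Finite C P] (f : P →ₗ[C] P) :
    Function.Surjective f ↔ IsUnit (LinearMap.det f) := by
  rw [← LinearMap.isUnit_iff_isUnit_det, Module.End.isUnit_iff]
  exact ⟨fun h => ⟨OrzechProperty.injective_of_surjective_endomorphism f h, h⟩, fun h => h.2⟩

/-- Inside the subfunctor attached to `β`, the one attached to `γ` is a basic open set. -/
theorem surjective_sectionMap_map_iff {B C : Type u} [CommRing B] [Algebra A B] [CommRing C]
    [Algebra A C] {e : F} {μ : R →ₐ[A] B ⊗[A] Module.End A F} {x : HilbPoint (A := A) R n B}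
    (hx : x.IsClassOf (family e μ)) (hs : Function.Surjective (family e μ))
    (hsC : ∀ φ : B →ₐ[A] C, Function.Surjective (family e (changeBase φ μ)))
    (γ : F →ₗ[A] R) (φ : B →ₐ[A] C) :
    Function.Surjective (sectionMap γ C (x.map φ).ideal) ↔
      IsUnit (φ (LinearMap.det (family e μ ∘ₗ γ.baseChange B))) := by
  let _ : Algebra B C := φ.toRingHom.toAlgebra
  have : IsScalarTower A B C := IsScalarTower.of_algebraMap_eq fun r => (φ.commutes r).symm
  -- With `Q` identified with `C ⊗ F`, the section map of `γ` is an endomorphism of a finite free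
  -- module. It is surjective exactly when its determinant is a unit, and determinants commute with
  -- base change.
  rw [sectionMap_surjective_iff γ _ _ (hsC φ) (hx.map hs φ), surjective_iff_isUnit_det]
  let c := AlgebraTensorModule.cancelBaseChange A B C C F
  have h1 : family e (changeBase φ μ) = c.toLinearMap ∘ₗ quotMap C (family e μ) :=
    family_changeBase μ
  have h2 : quotMap C (family e μ) ∘ₗ γ.baseChange C =
      (family e μ ∘ₗ γ.baseChange B).baseChange C ∘ₗ c.symm.toLinearMap := by
    refine TensorProduct.AlgebraTensorModule.ext fun y f => ?_
    simp [quotMap_tmul, c]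
  rw [h1, LinearMap.comp_assoc, h2, LinearMap.det_conj, LinearMap.det_baseChange]
  rfl

/-- The Hilbert functor of `n` points is representable by a scheme. -/
theorem isRepresentableByScheme_hilb (b : Module.Basis (Fin n) A F) (i : Fin n) :
    IsRepresentableByScheme (hilb A R n) := by
  let J := {β : F →ₗ[A] R // β (b i) = 1}
  -- Any presentation would do; `M = R` is always available.
  let π : SymmetricAlgebra A R →ₐ[A] R := SymmetricAlgebra.lift LinearMap.id
  have hπ : Function.Surjective π := fun r =>
    ⟨SymmetricAlgebra.ι A R r, SymmetricAlgebra.lift_ι_apply _ r⟩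
  let K : J → CommAlgCat.{u} A := fun β => CommAlgCat.of A (AlgHRSection π hπ (b i) β.1)
  choose Φ hΦ using fun β : J => exists_iso_hilbSection (n := n) π hπ b β.2
  let h : ∀ β, (hilb A R n).obj (K β) := fun β => ((Φ β).hom.app (K β) (𝟙 _)).1
  have hmap : ∀ (β : J) (C : CommAlgCat.{u} A) (ψ : K β ⟶ C),
      (hilb A R n).map ψ (h β) = ((Φ β).hom.app C ψ).1 := by
    intro β C ψ
    have := ConcreteCategory.congr_hom ((Φ β).hom.naturality ψ) (𝟙 (K β))
    have h1 := congrArg Subtype.val this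
    refine Eq.trans h1.symm ?_
    change ((Φ β).hom.app C (𝟙 _ ≫ ψ)).1 = _
    rw [Category.id_comp]
  have hmem : ∀ (β : J) (C : CommAlgCat.{u} A) (ψ : K β ⟶ C),
      (hilb A R n).map ψ (h β) ∈ (hilbSection n β.1).obj C := by
    intro β C ψ
    rw [hmap]
    exact ((Φ β).hom.app C ψ).2
  have hmono : ∀ (β : J) (C : CommAlgCat.{u} A) (ψ ψ' : K β ⟶ C),
      (hilb A R n).map ψ (h β) = (hilb A R n).map ψ' (h β) → ψ = ψ' := by
    intro β C ψ ψ' hh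
    rw [hmap, hmap] at hh
    exact ((isIso_iff_bijective ((Φ β).hom.app C)).1 inferInstance).1 (Subtype.ext hh)
  have hex : ∀ (β : J) (C : CommAlgCat.{u} A) (x : (hilb A R n).obj C),
      x ∈ (hilbSection n β.1).obj C → ∃ ψ : K β ⟶ C, (hilb A R n).map ψ (h β) = x := by
    intro β C x hx
    obtain ⟨ψ, hψ⟩ := ((isIso_iff_bijective ((Φ β).hom.app C)).1 inferInstance).2 ⟨x, hx⟩
    exact ⟨ψ, by rw [hmap, hψ]⟩
  let d : ∀ β γ : J, K β := fun β γ =>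
    LinearMap.det (universalFamily π hπ (b i) β.1 ∘ₗ γ.1.baseChange (AlgHRSection π hπ (b i) β.1))
  have hd : ∀ (β γ : J) (C : CommAlgCat.{u} A) (ψ : K β ⟶ C),
      (hilb A R n).map ψ (h β) ∈ (hilbSection n γ.1).obj C ↔ IsUnit (ψ.hom (d β γ)) := by
    intro β γ C ψ
    have hu := isCompatible_univHom π hπ (b i) β.1
    exact surjective_sectionMap_map_iff (hΦ β) hu.isSectionHom.surjective
      (fun φ => (hu.changeBase φ).isSectionHom.surjective) γ.1 ψ.hom
  let L : J → J → CommAlgCat.{u} A := fun β γ => CommAlgCat.of A (Localization.Away (d β γ))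
  let a : ∀ β γ, K β ⟶ L β γ := fun β γ => awayHom (K β) (d β γ)
  have ha : ∀ β γ, (hilb A R n).map (a β γ) (h β) ∈ (hilbSection n γ.1).obj (L β γ) :=
    fun β γ => (hd β γ _ _).2 (IsLocalization.Away.algebraMap_isUnit (d β γ))
  -- Over `L β γ` the universal point of `β` also lies in the chart of `γ`, so it is classified by a
  -- homomorphism from `K γ`, the second leg of the overlap.
  choose c hc using fun β γ => hex γ _ _ (ha β γ)
  refine isRepresentableByScheme_of_isOverlap (h := h) (a := a) (b := c) isZariskiSheaf_hilb
    (fun B x p => ?_) hmono ⟨fun β γ => (hc β γ).symm, fun β γ C ψ ψ' hh => ?_⟩ fun β γ => ?_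
  · obtain ⟨f, hf, β, hβ⟩ := (isOpenCovering_hilbSection b i).2 B x p
    obtain ⟨ψ, hψ⟩ := hex β _ _ hβ
    exact ⟨f, hf, β, ψ, hψ.symm⟩
  -- The common point lies in the chart of `γ`, being pulled back along `ψ'`. So `ψ` inverts the
  -- determinant and factors through the localization.
  · have hu : IsUnit (ψ.hom (d β γ)) := by
      rw [← hd, hh]
      exact hmem γ C ψ'
    let χ : L β γ ⟶ C := CommAlgCat.ofHom
      (IsLocalization.Away.liftAlgHom (d β γ) hu : Localization.Away (d β γ) →ₐ[A] C)
    have hχ : a β γ ≫ χ = ψ :=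
      CommAlgCat.hom_ext (AlgHom.ext fun x => IsLocalization.Away.lift_eq (d β γ) hu x)
    refine ⟨χ, hχ, hmono γ C _ _ ?_⟩
    rw [← map_map_apply, hc, map_map_apply, hχ, hh]
  · exact AlgebraicGeometry.Scheme.isOpenImmersion_SpecMap_localizationAway
      (R := CommRingCat.of (K β)) (d β γ)

end HilbOverlap

end
end HilbertPoints

theorem theorem5p4 {A : Type u} [CommRing A] {R : Type u} [CommRing R] [Algebra A R]
    {F : Type u} [AddCommGroup F] [Module A F] [Module.Free A F] [Module.Finite A F]
    (n : ℕ) (e : F) (he : ∃ (b : Module.Basis (Fin n) A F) (i : Fin n), b i = e) :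
    HilbertPoints.IsRepresentableByScheme (HilbertPoints.hilb A R n) ∧
    HilbertPoints.IsOpenCovering
      (fun β : {β : F →ₗ[A] R // β e = 1} => HilbertPoints.hilbSection n β.1) ∧
    ∀ (M : Type u) [AddCommGroup M] [Module A M] (π : SymmetricAlgebra A M →ₐ[A] R)
      (hπ : Function.Surjective π) (β : F →ₗ[A] R), β e = 1 →
      HilbertPoints.IsSectionHom e β (HilbertPoints.universalFamily π hπ e β) ∧
      ∃ Φ : coyoneda.obj (Opposite.op
            (CommAlgCat.of A (HilbertPoints.AlgHRSection π hπ e β))) ≅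
          (HilbertPoints.hilbSection n β).toFunctor,
        HilbertPoints.HilbPoint.IsClassOf
          (Φ.hom.app (CommAlgCat.of A (HilbertPoints.AlgHRSection π hπ e β)) (𝟙 _)).1
          (HilbertPoints.universalFamily π hπ e β) := by
  obtain ⟨b, i, rfl⟩ := he
  exact ⟨HilbertPoints.isRepresentableByScheme_hilb b i,
    HilbertPoints.isOpenCovering_hilbSection b i, fun M _ _ π hπ β hβ =>
    ⟨(HilbertPoints.isCompatible_univHom π hπ (b i) β).isSectionHom,
      HilbertPoints.exists_iso_hilbSection π hπ b hβ⟩⟩
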